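/- All graphs are finite, undirected, without loops or multiple edges, and have at least one vertex. For $k \ge 1$ let $\mathsf{C}_k$ be the $k$-variable fragment of first-order logic with counting quantifiers over graphs: formulas are built from a fixed set of $k$ variables (which may be requantified) using equality, adjacency, Boolean connectives, the first-order quantifiers $\exists, \forall$, and the counting quantifiers $\exists^{\ge j} x\,\varphi$ ("at least $j$ distinct vertices $x$ satisfy $\varphi$"); over vertex-colored graphs there is also an atomic formula "$x$ has color $c$" for each color $c$. A graph $G$ is defined in $\mathsf{C}_k$ if there is a sentence $\varphi \in \mathsf{C}_k$ such that for every graph $H$, $H \models \varphi$ if and only if $H \cong G$; for vertex-colored graphs with colors in a set $C$, $H$ ranges over all vertex-colored graphs with colors in $C$, and isomorphisms preserve colors. There is a function $k\colon \mathbb{N} \to \mathbb{N}$ with $k(n) = \frac{n}{4} + o(n)$ as $n \to \infty$ such that, for every $n \ge 1$, every $n$-vertex graph can be defined in $\mathsf{C}_{k(n)}$, and every $n$-vertex vertex-colored graph, with colors from an arbitrary set $C$, can be defined in $\mathsf{C}_{k(n)}$ (over graphs colored by $C$). The function $k$ depends neither on the graph nor on $C$ or the coloring. -/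

import Mathlib

open scoped Asymptotics

universe u v w

/-- Formulas of first-order logic with counting quantifiers over graphs whose vertices may carry
colors from `C`, using only the `k` variables `x i`, `i : Fin k` (which may be requantified).
The other connectives and quantifiers of first-order logic are the usual abbreviations.
For uncolored graphs, `C` is the empty type, so that there are no color atoms. -/
inductive CFormula (C : Type w) (k : ℕ) : Type w
  /-- the false formula -/
  | falsum : CFormula C k
  /-- `x i = x j` -/
  | equal (i j : Fin k) : CFormula C k
  /-- `x i` and `x j` are adjacent -/
  | adj (i j : Fin k) : CFormula C k
  /-- `x i` has color `c` -/
  | color (c : C) (i : Fin k) : CFormula C k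
  /-- implication -/
  | imp (φ ψ : CFormula C k) : CFormula C k
  /-- the universal quantifier `∀ x i, φ` -/
  | all (i : Fin k) (φ : CFormula C k) : CFormula C k
  /-- the counting quantifier: there are at least `m` distinct values of `x i` satisfying `φ` -/
  | atLeast (m : ℕ) (i : Fin k) (φ : CFormula C k) : CFormula C k

namespace CFormula

/-- The free variables of a formula. -/
def freeVars {C : Type w} {k : ℕ} : CFormula C k → Finset (Fin k)
  | falsum => ∅
  | equal i j => {i, j}
  | adj i j => {i, j}
  | color _ i => {i}
  | imp φ ψ => φ.freeVars ∪ ψ.freeVars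
  | all i φ => φ.freeVars.erase i
  | atLeast _ i φ => φ.freeVars.erase i

/-- A sentence is a formula without free variables. -/
def IsSentence {C : Type w} {k : ℕ} (φ : CFormula C k) : Prop :=
  φ.freeVars = ∅

/-- Truth of a formula in the graph `G`, where `P c` is the set of vertices of color `c`, under
the assignment `a` of vertices to the variables. -/
def Realize {C : Type w} {k : ℕ} {V : Type v} (G : SimpleGraph V) (P : C → Set V) :
    CFormula C k → (Fin k → V) → Prop
  | falsum, _ => False
  | equal i j, a => a i = a j
  | adj i j, a => G.Adj (a i) (a j)
  | color c i, a => a i ∈ P c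
  | imp φ ψ, a => φ.Realize G P a → ψ.Realize G P a
  | all i φ, a => ∀ x : V, φ.Realize G P (Function.update a i x)
  | atLeast m i φ, a =>
      ∃ s : Finset V, m ≤ s.card ∧ ∀ x ∈ s, φ.Realize G P (Function.update a i x)

/-- `G ⊨ φ`, for an uncolored graph `G` and a sentence `φ` (whose truth in a nonempty graph does
not depend on the assignment). -/
def Models {k : ℕ} {V : Type v} (G : SimpleGraph V) (φ : CFormula Empty k) : Prop :=
  ∀ a : Fin k → V, φ.Realize G (fun c => c.elim) a

/-- `(G, χ) ⊨ φ`, for a vertex-colored graph `(G, χ)` and a sentence `φ`. -/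
def ModelsColored {C : Type w} {k : ℕ} {V : Type v} (G : SimpleGraph V) (χ : V → C)
    (φ : CFormula C k) : Prop :=
  ∀ a : Fin k → V, φ.Realize G (fun c => {x | χ x = c}) a

end CFormula

/-- The graph `G` can be defined in the `k`-variable fragment of counting logic: some sentence of
this fragment holds in exactly those (finite, nonempty) graphs that are isomorphic to `G`. -/
def DefinableInC (k : ℕ) {V : Type u} (G : SimpleGraph V) : Prop :=
  ∃ φ : CFormula Empty k, φ.IsSentence ∧
    ∀ (W : Type v) [Finite W] [Nonempty W] (H : SimpleGraph W),
      CFormula.Models H φ ↔ Nonempty (H ≃g G)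

/-- The vertex-colored graph `(G, χ)` with colors in `C` can be defined in the `k`-variable
fragment of counting logic: some sentence of this fragment holds in exactly those (finite,
nonempty) vertex-colored graphs `(H, η)` with colors in `C` that are isomorphic to `(G, χ)`. -/
def DefinableInCColored (k : ℕ) {C : Type w} {V : Type u} (G : SimpleGraph V) (χ : V → C) :
    Prop :=
  ∃ φ : CFormula C k, φ.IsSentence ∧
    ∀ (W : Type v) [Finite W] [Nonempty W] (H : SimpleGraph W) (η : W → C),
      CFormula.ModelsColored H η φ ↔ ∃ e : H ≃g G, ∀ x : W, χ (e x) = η x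

/-!
Two structures satisfying the same sentences of the `k`-variable fragment are positions of the
bijective `k`-pebble game that Duplicator wins. Spoiler fixes `L` and pebbles greedily: he places a
pebble as long as this raises the potential of the partition of the vertices into types by at least
`4 * L`, where a part of size `m` has weight `L + 3 * min m L`. The potential is at most
`n * (L + 3)`, so that he stops after at most `n / 4 + 3 * n / (4 * L)` pebbles.

At that point a further pebble creates at most three new parts, and it does not split any part into
two parts of size at least `L`, since this alone would gain `L + 3 * L`. For every vertex `x` and
every type, hence, all but boundedly many vertices `y` of that type form pairs `(x, y)` of a single
type. The exceptional pairs form a graph of bounded degree, and each of its components meets each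
type in boundedly many vertices. As pebbling `x` splits at most three types, including its own, a
type is linked by exceptional pairs to at most two others. So the types met by a component lie on a
path or a cycle, along which the component can be explored with only the vertices at the two ends
pebbled. A number of additional pebbles that depends only on `L` thus suffices to show that
corresponding components are isomorphic. The components of the two structures are matched by
counting, and the pairs of vertices from different components, not being exceptional, are
determined by the types of their two vertices.
-/

lemma exists_equiv_of_ncard_eq {α β T : Type*} [Finite α] [Finite β] (f : α → T) (g : β → T)
    (h : ∀ t, {x | f x = t}.ncard = {y | g y = t}.ncard) : ∃ e : α ≃ β, ∀ x, g (e x) = f x := by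
  have fiberEquiv : ∀ t, Nonempty ({x // f x = t} ≃ {y // g y = t}) := fun t =>
    Finite.card_eq.1 (h t)
  let e := fun t => (fiberEquiv t).some
  exact ⟨Equiv.ofFiberEquiv e, Equiv.ofFiberEquiv_map e⟩

lemma exists_notMem_image_compl_singleton {ι : Type*} [Finite ι] (σ : ι → ι) (i : ι) :
    ∃ j, j ∉ σ '' {i}ᶜ := by
  by_contra! hsurj
  have hle : (Set.univ : Set ι).ncard ≤ ({i}ᶜ : Set ι).ncard :=
    (Set.ncard_le_ncard fun j _ => hsurj j).trans (Set.ncard_image_le ({i}ᶜ : Set ι).toFinite)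
  have hlt : ({i}ᶜ : Set ι).ncard < (Set.univ : Set ι).ncard :=
    Set.ncard_lt_ncard (Set.ssubset_univ_iff.2 (by simp))
  omega

lemma exists_enumeration_of_ncard_lt {α : Type*} {k : ℕ} {R : Set α} (hfin : R.Finite)
    (hne : R.Nonempty) (hcard : R.ncard < k) :
    ∃ (a : Fin k → α) (i₀ : Fin k), (∀ i, a i ∈ R) ∧ ∀ z ∈ R, ∃ i, i ≠ i₀ ∧ a i = z := by
  have := hfin.to_subtype
  have := hfin.fintype
  have hlt : Fintype.card R < Fintype.card (Fin k) := by
    rwa [Fintype.card_fin, ← Nat.card_eq_fintype_card, Nat.card_coe_set_eq]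
  obtain ⟨e⟩ := Function.Embedding.nonempty_of_card_le hlt.le
  obtain ⟨i₀, hi₀⟩ : ∃ i₀, i₀ ∉ Set.range e := by
    by_contra! hsurj
    exact hlt.not_ge (Fintype.card_le_of_surjective e hsurj)
  obtain ⟨r, hr⟩ := hne
  refine ⟨Function.extend e (↑) fun _ => r, i₀, fun i => ?_, fun z hz =>
    ⟨e ⟨z, hz⟩, fun h => hi₀ ⟨_, h⟩, e.injective.extend_apply _ _ _⟩⟩
  by_cases hi : ∃ z, e z = i
  · obtain ⟨z, rfl⟩ := hi
    rw [e.injective.extend_apply]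
    exact z.2
  · rwa [Function.extend_apply' _ _ _ hi]

lemma update_comp_of_notMem_image {ι κ α : Type*} [DecidableEq ι] [DecidableEq κ] (a : κ → α)
    (σ : ι → κ) {i : ι} {j : κ} (hj : j ∉ σ '' {i}ᶜ) (x : α) :
    Function.update (a ∘ σ) i x = Function.update a j x ∘ Function.update σ i j := by
  funext i'
  obtain rfl | hi := eq_or_ne i' i
  · simp
  · have hσ : σ i' ≠ j := fun h => hj ⟨i', hi, h⟩
    simp [hi, hσ]

namespace CFormula

variable {C : Type w} {k : ℕ} {V : Type u} {W : Type v}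

/-- Negation, as an abbreviation for implying `falsum`. -/
def neg (φ : CFormula C k) : CFormula C k := imp φ falsum

/-- The conjunction of a finite list of formulas; the empty conjunction is true. -/
def conj : List (CFormula C k) → CFormula C k
  | [] => neg falsum
  | φ :: l => neg (imp φ (neg (conj l)))

/-- The universal closure: all `k` variables are quantified, whether or not they are free. -/
def univClosure (φ : CFormula C k) : CFormula C k := (List.finRange k).foldr all φ

section Realize

variable (G : SimpleGraph V) (P : C → Set V)

@[simp] lemma realize_neg (φ : CFormula C k) (a : Fin k → V) :
    φ.neg.Realize G P a ↔ ¬ φ.Realize G P a := Iff.rfl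

@[simp] lemma realize_conj (l : List (CFormula C k)) (a : Fin k → V) :
    (conj l).Realize G P a ↔ ∀ φ ∈ l, φ.Realize G P a := by
  induction l with
  | nil => simp [conj, Realize]
  | cons φ l ih =>
    simp only [conj, realize_neg, Realize, ih, List.mem_cons, forall_eq_or_imp]
    tauto

lemma realize_foldr_all (l : List (Fin k)) (φ : CFormula C k) (a : Fin k → V) :
    (l.foldr all φ).Realize G P a ↔ ∀ b, (∀ i, i ∉ l → b i = a i) → φ.Realize G P b := by
  induction l generalizing a with
  | nil =>
    refine ⟨fun h b hb => ?_, fun h => h a fun _ _ => rfl⟩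
    rwa [funext fun i => hb i List.not_mem_nil]
  | cons j l ih =>
    simp only [List.foldr_cons, Realize, ih, List.mem_cons, not_or]
    refine ⟨fun h b hb => h (b j) b fun i hi => ?_, fun h x b hb => h b fun i hi => ?_⟩
    · obtain rfl | hij := eq_or_ne i j
      · rw [Function.update_self]
      · rw [Function.update_of_ne hij, hb i ⟨hij, hi⟩]
    · rw [hb i hi.2, Function.update_of_ne hi.1]

@[simp] lemma realize_univClosure (φ : CFormula C k) (a : Fin k → V) :
    φ.univClosure.Realize G P a ↔ ∀ b, φ.Realize G P b := by
  simp [univClosure, realize_foldr_all]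

lemma realize_atLeast [Finite V] (m : ℕ) (i : Fin k) (φ : CFormula C k) (a : Fin k → V) :
    (atLeast m i φ).Realize G P a ↔
      m ≤ {x | φ.Realize G P (Function.update a i x)}.ncard := by
  simp only [Realize]
  constructor
  · rintro ⟨s, hs, h⟩
    rw [← Set.ncard_coe_finset] at hs
    exact hs.trans (Set.ncard_le_ncard h)
  · intro h
    refine ⟨(Set.toFinite {x | φ.Realize G P (Function.update a i x)}).toFinset, ?_, by simp⟩
    rwa [← Set.ncard_eq_toFinset_card]

end Realize

lemma freeVars_neg (φ : CFormula C k) : φ.neg.freeVars = φ.freeVars :=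
  Finset.union_empty _

lemma IsSentence.neg {φ : CFormula C k} (h : φ.IsSentence) : φ.neg.IsSentence :=
  (freeVars_neg φ).trans h

lemma isSentence_conj {l : List (CFormula C k)} (h : ∀ φ ∈ l, φ.IsSentence) :
    (conj l).IsSentence := by
  induction l with
  | nil => rfl
  | cons φ l ih =>
    have hφ : φ.freeVars = ∅ := h φ List.mem_cons_self
    have hl : (conj l).freeVars = ∅ := ih fun ψ hψ => h ψ (List.mem_cons_of_mem φ hψ)
    simp [IsSentence, conj, freeVars_neg, freeVars, hφ, hl]

lemma freeVars_foldr_all (l : List (Fin k)) (φ : CFormula C k) :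
    (l.foldr all φ).freeVars = φ.freeVars \ l.toFinset := by
  induction l with
  | nil => simp
  | cons j l ih =>
    rw [List.foldr_cons, freeVars, ih, List.toFinset_cons, Finset.sdiff_insert]

lemma isSentence_univClosure (φ : CFormula C k) : φ.univClosure.IsSentence := by
  rw [IsSentence, univClosure, freeVars_foldr_all, List.toFinset_finRange]
  exact Finset.sdiff_eq_empty_iff_subset.2 (Finset.subset_univ _)

/-- A relation between assignments that is a winning strategy for Duplicator in the bijective
`k`-pebble game: related assignments satisfy the same atoms, and `extend` answers every move. -/
structure IsBackAndForth (G : SimpleGraph V) (P : C → Set V) (H : SimpleGraph W) (Q : C → Set W)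
    (R : (Fin k → V) → (Fin k → W) → Prop) : Prop where
  equal_iff : ∀ {a b}, R a b → ∀ i j, a i = a j ↔ b i = b j
  adj_iff : ∀ {a b}, R a b → ∀ i j, G.Adj (a i) (a j) ↔ H.Adj (b i) (b j)
  color_iff : ∀ {a b}, R a b → ∀ i c, a i ∈ P c ↔ b i ∈ Q c
  extend : ∀ {a b}, R a b → ∀ i, ∃ f : V ≃ W, ∀ x,
    R (Function.update a i x) (Function.update b i (f x))

section BackAndForth

variable {G : SimpleGraph V} {P : C → Set V} {H : SimpleGraph W} {Q : C → Set W}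

lemma IsBackAndForth.realize_iff {R : (Fin k → V) → (Fin k → W) → Prop}
    (hR : IsBackAndForth G P H Q R) (φ : CFormula C k) {a : Fin k → V} {b : Fin k → W}
    (hab : R a b) : φ.Realize G P a ↔ φ.Realize H Q b := by
  induction φ generalizing a b with
  | falsum => rfl
  | equal i j => exact hR.equal_iff hab i j
  | adj i j => exact hR.adj_iff hab i j
  | color c i => exact hR.color_iff hab i c
  | imp φ ψ ihφ ihψ => exact imp_congr (ihφ hab) (ihψ hab)
  | all i φ ih =>
    obtain ⟨f, hf⟩ := hR.extend hab i
    simp only [Realize]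
    rw [← f.forall_congr_right]
    exact forall_congr' fun x => ih (hf x)
  | atLeast m i φ ih =>
    obtain ⟨f, hf⟩ := hR.extend hab i
    simp only [Realize]
    refine f.finsetCongr.exists_congr fun s => ?_
    simp only [Equiv.finsetCongr_apply, Finset.card_map, Finset.forall_mem_map,
      Equiv.coe_toEmbedding, ← ih (hf _)]

/-- An isomorphism of structures in which `P c` and `Q c` are the sets of vertices of color `c`. -/
structure Iso (G : SimpleGraph V) (P : C → Set V) (H : SimpleGraph W) (Q : C → Set W)
    extends G ≃g H where
  mem_color_iff : ∀ c x, x ∈ P c ↔ toEquiv x ∈ Q c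

lemma Iso.realize_iff (e : Iso G P H Q) (φ : CFormula C k) (a : Fin k → V) :
    φ.Realize G P a ↔ φ.Realize H Q (e.toEquiv ∘ a) := by
  refine IsBackAndForth.realize_iff (R := fun a b => b = e.toEquiv ∘ a)
    ⟨?_, ?_, ?_, ?_⟩ φ rfl
  · rintro a _ rfl i j
    exact e.toEquiv.injective.eq_iff.symm
  · rintro a _ rfl i j
    exact e.map_rel_iff'.symm
  · rintro a _ rfl i c
    exact e.mem_color_iff c _
  · rintro a _ rfl i
    exact ⟨e.toEquiv, fun x => (Function.comp_update e.toEquiv a i x).symm⟩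

end BackAndForth

/-- The set of formulas satisfied by an assignment, that is, its complete type in the `k`-variable
fragment. -/
def theory (G : SimpleGraph V) (P : C → Set V) (a : Fin k → V) : Set (CFormula C k) :=
  {φ | φ.Realize G P a}

section Theory

variable {G : SimpleGraph V} {P : C → Set V} {H : SimpleGraph W} {Q : C → Set W}
  {a : Fin k → V} {b : Fin k → W}

lemma theory_eq_of_subset (h : theory G P a ⊆ theory H Q b) : theory G P a = theory H Q b :=
  h.antisymm fun φ hφ => by_contra fun hn => h (a := φ.neg) hn hφ

lemma exists_realize_iff_theory_eq {ι : Type*} [Finite ι] (t : ι → Set (CFormula C k))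
    (hneg : ∀ i φ, neg φ ∈ t i ↔ φ ∉ t i) (hconj : ∀ i l, conj l ∈ t i ↔ ∀ φ ∈ l, φ ∈ t i)
    (i : ι) : ∃ φ, ∀ j, φ ∈ t j ↔ t j = t i := by
  cases nonempty_fintype ι
  have separated : ∀ j, ∃ φ, φ ∈ t i ∧ (φ ∈ t j → t j = t i) := by
    intro j
    by_cases h : t i ⊆ t j
    · refine ⟨conj [], (hconj i []).2 (by simp), fun _ => (h.antisymm fun φ hφ => ?_).symm⟩
      exact by_contra fun hn => (hneg j φ).1 (h ((hneg i φ).2 hn)) hφ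
    · obtain ⟨φ, hi, hj⟩ := Set.not_subset.1 h
      exact ⟨φ, hi, fun h => absurd h hj⟩
  choose ψ hψi hψj using separated
  refine ⟨conj (Finset.univ.toList.map ψ), fun j => ⟨fun h => ?_, fun h => ?_⟩⟩
  · exact hψj j ((hconj j _).1 h _ (by simp))
  · rw [h, hconj]
    simpa using hψi

lemma ncard_theory_update_eq [Finite V] [Finite W] (h : theory G P a = theory H Q b) (i : Fin k)
    (t : Set (CFormula C k)) :
    {x | theory G P (Function.update a i x) = t}.ncard =
      {y | theory H Q (Function.update b i y) = t}.ncard := by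
  let th : V ⊕ W → Set (CFormula C k) := Sum.elim (fun x => theory G P (Function.update a i x))
    fun y => theory H Q (Function.update b i y)
  by_cases ht : t ∈ Set.range th
  · obtain ⟨z, rfl⟩ := ht
    obtain ⟨φ, hφ⟩ := exists_realize_iff_theory_eq th (by rintro (x | x) φ <;> rfl)
      (by rintro (x | x) l <;> simp [th, theory]) z
    rw [show {x | theory G P (Function.update a i x) = th z} =
        {x | φ.Realize G P (Function.update a i x)} from Set.ext fun x => (hφ (.inl x)).symm,
      show {y | theory H Q (Function.update b i y) = th z} =
        {y | φ.Realize H Q (Function.update b i y)} from Set.ext fun y => (hφ (.inr y)).symm]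
    refine eq_of_forall_le_iff fun m => ?_
    rw [← realize_atLeast, ← realize_atLeast]
    exact Set.ext_iff.1 h (atLeast m i φ)
  · rw [show {x | theory G P (Function.update a i x) = t} = ∅ from
        Set.eq_empty_of_forall_notMem fun x hx => ht ⟨.inl x, hx⟩,
      show {y | theory H Q (Function.update b i y) = t} = ∅ from
        Set.eq_empty_of_forall_notMem fun y hy => ht ⟨.inr y, hy⟩,
      Set.ncard_empty, Set.ncard_empty]

lemma exists_equiv_of_theory_eq [Finite V] [Finite W] (h : theory G P a = theory H Q b)
    (i : Fin k) : ∃ f : V ≃ W, ∀ x,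
      theory G P (Function.update a i x) = theory H Q (Function.update b i (f x)) := by
  obtain ⟨f, hf⟩ := exists_equiv_of_ncard_eq _ _ (ncard_theory_update_eq h i)
  exact ⟨f, fun x => (hf x).symm⟩

lemma theory_comp_eq [Finite V] [Finite W] (h : theory G P a = theory H Q b)
    (σ : Fin k → Fin k) : theory G P (a ∘ σ) = theory H Q (b ∘ σ) := by
  let R : (Fin k → V) → (Fin k → W) → Prop := fun a' b' => ∃ a b, ∃ σ : Fin k → Fin k,
    theory G P a = theory H Q b ∧ a' = a ∘ σ ∧ b' = b ∘ σ
  have hR : IsBackAndForth G P H Q R := by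
    constructor
    · rintro _ _ ⟨a, b, σ, h, rfl, rfl⟩ i j
      exact Set.ext_iff.1 h (equal (σ i) (σ j))
    · rintro _ _ ⟨a, b, σ, h, rfl, rfl⟩ i j
      exact Set.ext_iff.1 h (adj (σ i) (σ j))
    · rintro _ _ ⟨a, b, σ, h, rfl, rfl⟩ i c
      exact Set.ext_iff.1 h (color c (σ i))
    · rintro _ _ ⟨a, b, σ, h, rfl, rfl⟩ i
      -- Variable `j` is no longer used once `i` is overwritten, so it can hold the new vertex.
      obtain ⟨j, hj⟩ := exists_notMem_image_compl_singleton σ i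
      obtain ⟨f, hf⟩ := exists_equiv_of_theory_eq h j
      exact ⟨f, fun x => ⟨_, _, Function.update σ i j, hf x,
        update_comp_of_notMem_image a σ hj x, update_comp_of_notMem_image b σ hj (f x)⟩⟩
  exact Set.ext fun φ => hR.realize_iff φ ⟨a, b, σ, h, rfl, rfl⟩

lemma exists_theory_const_eq [Finite W] [Nonempty W] [NeZero k]
    (h : ∀ φ : CFormula C k, φ.IsSentence → (∀ a, φ.Realize G P a) → ∀ b, φ.Realize H Q b)
    (x : V) : ∃ y : W, theory G P (fun _ : Fin k => x) = theory H Q fun _ => y := by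
  cases nonempty_fintype W
  by_contra! hne
  have separated : ∀ y, ∃ φ : CFormula C k, φ.Realize G P (fun _ => x) ∧
      ¬ φ.Realize H Q fun _ => y := fun y => Set.not_subset.1 (mt theory_eq_of_subset (hne y))
  choose ψ hψx hψy using separated
  let allEqual : CFormula C k := conj ((List.finRange k).map fun i => equal i 0)
  let θ : CFormula C k := conj (allEqual :: Finset.univ.toList.map ψ)
  have hG : θ.Realize G P fun _ => x := by
    simpa [θ, allEqual, Realize] using hψx
  have hH : ∀ b, ¬ θ.Realize H Q b := by
    intro b hb
    obtain ⟨hconst, hb⟩ : (∀ i, b i = b 0) ∧ ∀ y, (ψ y).Realize H Q b := by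
      simpa [θ, allEqual, Realize] using hb
    exact hψy (b 0) ((funext hconst : b = fun _ => b 0) ▸ hb (b 0))
  have hall := h _ (isSentence_univClosure θ.neg).neg fun a => by
    simpa using ⟨_, hG⟩
  obtain ⟨b, hb⟩ : ∃ b : Fin k → W, θ.Realize H Q b := by
    simpa using hall
  exact hH b hb

end Theory

end CFormula

/-- A position of the bijective `k`-pebble game on one board: a graph with color classes `col c`
and `s` pebbles placed on it. The number `k` of variables does not occur in the data; it fixes the
formulas by which positions are compared. -/
structure PebbledGraph (C : Type w) (V : Type u) (k s : ℕ) where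
  /-- the graph -/
  graph : SimpleGraph V
  /-- the color classes -/
  col : C → Set V
  /-- the positions of the pebbles -/
  peb : Fin s → V

namespace PebbledGraph

variable {C : Type w} {V : Type u} {W : Type v} {U : Type*} {k s : ℕ}

/-- The complete type of an assignment. -/
def th (M : PebbledGraph C V k s) (a : Fin k → V) : Set (CFormula C k) :=
  CFormula.theory M.graph M.col a

/-- Placing one more pebble. -/
def cons (x : V) (M : PebbledGraph C V k s) : PebbledGraph C V k (s + 1) :=
  ⟨M.graph, M.col, Fin.cons x M.peb⟩

/-- The pairs of vertices on which corresponding pebbles of the two boards are placed. -/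
def pebPairs (M : PebbledGraph C V k s) (N : PebbledGraph C W k s) : Set (V × W) :=
  Set.range fun j => (M.peb j, N.peb j)

/-- Any two assignments that correspond to each other under the placed pebbles and the pairs
in `A` satisfy the same formulas; so `A` consists of pairs that Duplicator can afford to have
pebbled in addition, any number of them at a time as long as `k` pebbles suffice. -/
def Sim (M : PebbledGraph C V k s) (N : PebbledGraph C W k s) (A : Set (V × W)) : Prop :=
  ∀ a : Fin k → V × W, (∀ i, a i ∈ A ∪ M.pebPairs N) →
    M.th (Prod.fst ∘ a) = N.th (Prod.snd ∘ a)

variable {M : PebbledGraph C V k s} {N : PebbledGraph C W k s} {O : PebbledGraph C U k s}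

lemma Sim.mono {A B : Set (V × W)} (h : M.Sim N A) (hB : B ⊆ A) : M.Sim N B :=
  fun a ha => h a fun i => Set.union_subset_union_left _ hB (ha i)

lemma Sim.refl {A : Set (V × V)} (hA : A ⊆ Set.diagonal V) : M.Sim M A := by
  intro a ha
  congr 1
  funext i
  obtain h | ⟨j, hj⟩ := ha i
  · exact hA h
  · simp [← hj]

lemma Sim.symm {A : Set (V × W)} {B : Set (W × V)} (h : M.Sim N A)
    (hB : B ⊆ Prod.swap ⁻¹' A) : N.Sim M B := by
  intro a ha
  refine (h (Prod.swap ∘ a) fun i => ?_).symm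
  obtain h | ⟨j, hj⟩ := ha i
  · exact Or.inl (hB h)
  · exact Or.inr ⟨j, congrArg Prod.swap hj⟩

lemma Sim.trans {A : Set (V × W)} {B : Set (W × U)} {E : Set (V × U)} (h : M.Sim N A)
    (h' : N.Sim O B) (hE : ∀ z ∈ E, ∃ y, (z.1, y) ∈ A ∧ (y, z.2) ∈ B) : M.Sim O E := by
  intro a ha
  have exists_middle : ∀ i, ∃ y, ((a i).1, y) ∈ A ∪ M.pebPairs N ∧
      (y, (a i).2) ∈ B ∪ N.pebPairs O := by
    intro i
    obtain h | ⟨j, hj⟩ := ha i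
    · obtain ⟨y, hA, hB⟩ := hE _ h
      exact ⟨y, Or.inl hA, Or.inl hB⟩
    · exact ⟨N.peb j, Or.inr ⟨j, by simp [← hj]⟩, Or.inr ⟨j, by simp [← hj]⟩⟩
  choose y hA hB using exists_middle
  exact (h (fun i => ((a i).1, y i)) hA).trans (h' (fun i => (y i, (a i).2)) hB)

lemma pebPairs_cons (x : V) (y : W) :
    (cons x M).pebPairs (cons y N) = insert (x, y) (M.pebPairs N) := by
  simp only [pebPairs, cons]
  rw [← Fin.range_cons]
  congr 1
  funext j
  cases j using Fin.cases <;> rfl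

lemma sim_cons {x : V} {y : W} {A : Set (V × W)} :
    (cons x M).Sim (cons y N) A ↔ M.Sim N (insert (x, y) A) := by
  simp only [Sim, pebPairs_cons, Set.union_insert, Set.insert_union]
  rfl

lemma ncard_union_pebPairs_le (M : PebbledGraph C V k s) (N : PebbledGraph C W k s)
    (A : Set (V × W)) : (A ∪ M.pebPairs N).ncard ≤ s + A.ncard := by
  have hle : (M.pebPairs N).ncard ≤ s := by
    rw [pebPairs, ← Set.image_univ]
    simpa [Set.ncard_univ] using Set.ncard_image_le (f := fun j => (M.peb j, N.peb j))
      (Set.toFinite (Set.univ : Set (Fin s)))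
  have := Set.ncard_union_le A (M.pebPairs N)
  omega

lemma Sim.exists_equiv [Finite V] [Finite W] [NeZero s] {A : Set (V × W)} (h : M.Sim N A)
    (hA : s + A.ncard < k) : ∃ f : V ≃ W, ∀ x, M.Sim N (insert (x, f x) A) := by
  obtain ⟨a, i₀, haR, ha⟩ := exists_enumeration_of_ncard_lt (Set.toFinite (A ∪ M.pebPairs N))
    ⟨_, Or.inr ⟨0, rfl⟩⟩ ((ncard_union_pebPairs_le M N A).trans_lt hA)
  obtain ⟨f, hf⟩ := CFormula.exists_equiv_of_theory_eq (h a haR) i₀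
  refine ⟨f, fun x b hb => ?_⟩
  have b_mem : ∀ i, ∃ j, Function.update a i₀ (x, f x) j = b i := by
    intro i
    rw [Set.insert_union] at hb
    obtain h | h := hb i
    · exact ⟨i₀, by rw [h, Function.update_self]⟩
    · obtain ⟨j, hj, hab⟩ := ha _ h
      exact ⟨j, by rw [Function.update_of_ne hj, hab]⟩
  choose σ hσ using b_mem
  obtain rfl : Function.update a i₀ (x, f x) ∘ σ = b := funext hσ
  have hcomp := CFormula.theory_comp_eq (hf x) σ
  rwa [← Function.comp_update Prod.fst a i₀ (x, f x),
    ← Function.comp_update Prod.snd a i₀ (x, f x)] at hcomp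

lemma Sim.exists_pair [Finite V] [Finite W] [NeZero s] {A : Set (V × W)} (h : M.Sim N A)
    (hA : s + A.ncard < k) (x : V) : ∃ y, M.Sim N (insert (x, y) A) := by
  obtain ⟨f, hf⟩ := h.exists_equiv hA
  exact ⟨f x, hf x⟩

section Atoms

variable {A : Set (V × W)} {x y : V} {x' y' : W}

lemma Sim.mem_col_iff (h : M.Sim N A) (hk : 0 < k) (hx : (x, x') ∈ A) (c : C) :
    x ∈ M.col c ↔ x' ∈ N.col c :=
  Set.ext_iff.1 (h (fun _ => (x, x')) fun _ => Or.inl hx) (CFormula.color c ⟨0, hk⟩)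

lemma Sim.exists_assignment (h : M.Sim N A) (hk : 1 < k) (hx : (x, x') ∈ A) (hy : (y, y') ∈ A) :
    ∃ (a : Fin k → V × W) (i j : Fin k), a i = (x, x') ∧ a j = (y, y') ∧
      M.th (Prod.fst ∘ a) = N.th (Prod.snd ∘ a) := by
  let i : Fin k := ⟨0, by omega⟩
  let j : Fin k := ⟨1, hk⟩
  have hji : j ≠ i := fun h => absurd (congrArg Fin.val h) one_ne_zero
  exact ⟨fun l => if l = i then (x, x') else (y, y'), i, j, if_pos rfl, if_neg hji,
    h _ fun l => Or.inl (by split_ifs <;> assumption)⟩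

lemma Sim.eq_iff (h : M.Sim N A) (hk : 1 < k) (hx : (x, x') ∈ A) (hy : (y, y') ∈ A) :
    x = y ↔ x' = y' := by
  obtain ⟨a, i, j, hi, hj, hth⟩ := h.exists_assignment hk hx hy
  have := Set.ext_iff.1 hth (CFormula.equal i j)
  simpa [th, CFormula.theory, CFormula.Realize, hi, hj] using this

lemma Sim.adj_iff (h : M.Sim N A) (hk : 1 < k) (hx : (x, x') ∈ A) (hy : (y, y') ∈ A) :
    M.graph.Adj x y ↔ N.graph.Adj x' y' := by
  obtain ⟨a, i, j, hi, hj, hth⟩ := h.exists_assignment hk hx hy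
  have := Set.ext_iff.1 hth (CFormula.adj i j)
  simpa [th, CFormula.theory, CFormula.Realize, hi, hj] using this

end Atoms

/-- The vertices `x` and `y` satisfy the same formulas about them and the pebbles. -/
def SameType (M : PebbledGraph C V k s) (N : PebbledGraph C W k s) (x : V) (y : W) : Prop :=
  M.Sim N {(x, y)}

/-- The pairs `(x, y)` and `(x', y')` satisfy the same formulas about them and the pebbles. -/
def SamePairType (M : PebbledGraph C V k s) (N : PebbledGraph C W k s) (x y : V) (x' y' : W) :
    Prop :=
  M.Sim N {(x, x'), (y, y')}

lemma SameType.refl (M : PebbledGraph C V k s) (x : V) : M.SameType M x x := Sim.refl (by simp)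

lemma SamePairType.refl (M : PebbledGraph C V k s) (x y : V) : M.SamePairType M x y x y :=
  Sim.refl (by simp [Set.insert_subset_iff])

lemma SameType.symm {x : V} {x' : W} (h : M.SameType N x x') : N.SameType M x' x :=
  Sim.symm h (by simp)

lemma SamePairType.symm {x y : V} {x' y' : W} (h : M.SamePairType N x y x' y') :
    N.SamePairType M x' y' x y :=
  Sim.symm h (by simp [Set.insert_subset_iff])

lemma SameType.trans {x : V} {x' : W} {x'' : U} (h : M.SameType N x x')
    (h' : N.SameType O x' x'') : M.SameType O x x'' :=
  Sim.trans h h' (by simp)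

lemma SamePairType.trans {x y : V} {x' y' : W} {x'' y'' : U} (h : M.SamePairType N x y x' y')
    (h' : N.SamePairType O x' y' x'' y'') : M.SamePairType O x y x'' y'' := by
  refine Sim.trans h h' ?_
  rintro _ (rfl | rfl)
  · exact ⟨x', by simp⟩
  · exact ⟨y', by simp⟩

lemma SamePairType.swap {x y : V} {x' y' : W} (h : M.SamePairType N x y x' y') :
    M.SamePairType N y x y' x' :=
  Sim.mono h (Set.pair_comm _ _).subset

lemma SamePairType.left {x y : V} {x' y' : W} (h : M.SamePairType N x y x' y') :
    M.SameType N x x' :=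
  Sim.mono h (by simp)

lemma SamePairType.right {x y : V} {x' y' : W} (h : M.SamePairType N x y x' y') :
    M.SameType N y y' :=
  h.swap.left

lemma SamePairType.eq_iff {x y : V} {x' y' : W} (h : M.SamePairType N x y x' y') (hk : 1 < k) :
    x = y ↔ x' = y' :=
  Sim.eq_iff h hk (by simp) (by simp)

lemma sameType_cons {x y : V} {x' y' : W} :
    (cons x M).SameType (cons x' N) y y' ↔ M.SamePairType N x y x' y' :=
  sim_cons

/-- The vertices of the same type as `x`. -/
def typeClass (M : PebbledGraph C V k s) (x : V) : Set V := {y | M.SameType M x y}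

/-- The vertices of the same type as `y` after `x` is pebbled. -/
def cell (M : PebbledGraph C V k s) (x y : V) : Set V := (cons x M).typeClass y

lemma mem_typeClass {x y : V} : y ∈ M.typeClass x ↔ M.SameType M x y := Iff.rfl

lemma mem_cell {x y z : V} : z ∈ M.cell x y ↔ M.SamePairType M x y x z := sameType_cons

lemma mem_typeClass_self (x : V) : x ∈ M.typeClass x := SameType.refl M x

lemma typeClass_eq_iff {x y : V} : M.typeClass x = M.typeClass y ↔ M.SameType M x y := by
  refine ⟨fun h => h.symm.subset (mem_typeClass_self y), fun h => Set.ext fun z => ?_⟩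
  exact ⟨h.symm.trans, h.trans⟩

lemma cell_eq_iff {x y z : V} : M.cell x y = M.cell x z ↔ M.SamePairType M x y x z :=
  typeClass_eq_iff.trans sameType_cons

lemma typeClass_eq_of_mem {x y : V} (h : y ∈ M.typeClass x) : M.typeClass y = M.typeClass x :=
  (typeClass_eq_iff.2 h).symm

lemma cell_subset_typeClass (x y : V) : M.cell x y ⊆ M.typeClass y :=
  fun _ hz => (mem_cell.1 hz).right

lemma exists_comp_cell_eq_typeClass (M : PebbledGraph C V k s) (x : V) :
    ∃ r : Set V → Set V, r ∘ M.cell x = M.typeClass := by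
  have hfactors : Function.FactorsThrough M.typeClass (M.cell x) := fun y z h =>
    typeClass_eq_iff.2 (cell_eq_iff.1 h).right
  exact ⟨Function.extend (M.cell x) M.typeClass id, funext fun y => hfactors.extend_apply _ y⟩

lemma cell_self (hk : 1 < k) (x : V) : M.cell x x = {x} := by
  ext y
  rw [mem_cell, Set.mem_singleton_iff]
  refine ⟨fun h => ?_, fun h => h ▸ SamePairType.refl M y y⟩
  exact ((h.eq_iff hk).1 rfl).symm

variable [Finite V]

lemma ncard_typeClass_pos (x : V) : 0 < (M.typeClass x).ncard :=
  (Set.ncard_pos (Set.toFinite _)).2 ⟨x, mem_typeClass_self x⟩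

section Extension

variable [Finite W]

lemma Sim.exists_equiv_sameType [NeZero s] {A : Set (V × W)} (h : M.Sim N A) (hk : s < k) :
    ∃ f : V ≃ W, ∀ x, M.SameType N x (f x) := by
  obtain ⟨f, hf⟩ := (h.mono (Set.empty_subset A)).exists_equiv (by simpa using hk)
  exact ⟨f, fun x => (hf x).mono (by simp)⟩

lemma SameType.exists_equiv_samePairType [NeZero s] {x : V} {x' : W} (h : M.SameType N x x')
    (hk : s + 1 < k) : ∃ f : V ≃ W, ∀ y, M.SamePairType N x y x' (f y) := by
  obtain ⟨f, hf⟩ := Sim.exists_equiv h (by simpa using hk)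
  exact ⟨f, fun y => Sim.mono (hf y) (Set.pair_comm _ _).subset⟩

lemma SameType.exists_samePairType [NeZero s] {x : V} {x' : W} (h : M.SameType N x x')
    (hk : s + 1 < k) (y : V) : ∃ y', M.SamePairType N x y x' y' := by
  obtain ⟨f, hf⟩ := h.exists_equiv_samePairType hk
  exact ⟨f y, hf y⟩

lemma SamePairType.exists_samePairType [NeZero s] {x y : V} {x' y' : W}
    (h : M.SamePairType N x y x' y') (hk : s + 2 < k) (z : V) :
    ∃ z', M.SamePairType N x z x' z' ∧ M.SamePairType N z y z' y' := by
  have hcard : ({(x, x'), (y, y')} : Set (V × W)).ncard ≤ 2 :=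
    (Set.ncard_insert_le _ _).trans (by simp)
  obtain ⟨z', hz⟩ := Sim.exists_pair h (by omega) z
  refine ⟨z', Sim.mono hz ?_, Sim.mono hz ?_⟩ <;> simp [Set.insert_subset_iff]

lemma SameType.ncard_typeClass_eq [NeZero s] {x : V} {x' : W} (h : M.SameType N x x')
    (hk : s < k) : (M.typeClass x).ncard = (N.typeClass x').ncard := by
  obtain ⟨f, hf⟩ := Sim.exists_equiv_sameType h hk
  have himage : f ⁻¹' N.typeClass x' = M.typeClass x := Set.ext fun z =>
    ⟨fun hz => (h.trans hz).trans (hf z).symm, fun hz => (h.symm.trans hz).trans (hf z)⟩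
  rw [← himage, Set.ncard_preimage_of_injective_subset_range f.injective (by simp)]

lemma SamePairType.ncard_cell_eq {x y : V} {x' y' : W} (h : M.SamePairType N x y x' y')
    (hk : s + 1 < k) : (M.cell x y).ncard = (N.cell x' y').ncard :=
  (sameType_cons.2 h).ncard_typeClass_eq hk

lemma SameType.ncard_setOf_samePairType [NeZero s] {x : V} {x' : W} (h : M.SameType N x x')
    (hk : s + 1 < k) (y : V) :
    {z | M.SamePairType N x y x' z}.ncard = (M.cell x y).ncard := by
  obtain ⟨y', hy'⟩ := h.exists_samePairType hk y
  rw [hy'.ncard_cell_eq hk]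
  congr 1
  ext z
  rw [mem_cell]
  exact ⟨hy'.symm.trans, hy'.trans⟩

end Extension

/-- The pair `(x, y)` does not have the type of the majority of the pairs `(x, z)` with `z` of the
same type as `y`. -/
def Exceptional (M : PebbledGraph C V k s) (x y : V) : Prop :=
  2 * (M.cell x y).ncard ≤ (M.typeClass y).ncard

lemma Exceptional.cell_ne_typeClass {x y : V} (h : M.Exceptional x y) :
    M.cell x y ≠ M.typeClass y := by
  intro heq
  have hpos := ncard_typeClass_pos (M := M) y
  rw [Exceptional, heq] at h
  omega

lemma cell_eq_of_not_exceptional {x y z : V} (hyz : M.typeClass y = M.typeClass z)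
    (hy : ¬ M.Exceptional x y) (hz : ¬ M.Exceptional x z) : M.cell x y = M.cell x z := by
  by_contra hne
  have hdisj : Disjoint (M.cell x y) (M.cell x z) := by
    refine Set.disjoint_left.2 fun u hu hu' => hne ?_
    exact (typeClass_eq_of_mem hu).symm.trans (typeClass_eq_of_mem hu')
  have hsub : M.cell x y ∪ M.cell x z ⊆ M.typeClass z :=
    Set.union_subset (hyz ▸ cell_subset_typeClass x y) (cell_subset_typeClass x z)
  have hle := Set.ncard_le_ncard hsub
  rw [Set.ncard_union_eq hdisj] at hle
  rw [Exceptional, hyz] at hy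
  rw [Exceptional] at hz
  omega

variable [NeZero s]

lemma SamePairType.exceptional_iff [Finite W] {x y : V} {x' y' : W}
    (h : M.SamePairType N x y x' y') (hk : s + 1 < k) :
    M.Exceptional x y ↔ N.Exceptional x' y' := by
  rw [Exceptional, Exceptional, h.ncard_cell_eq hk, h.right.ncard_typeClass_eq (by omega)]

lemma ncard_typeClass_mul_ncard_cell (hk : s + 1 < k) (x y : V) :
    (M.typeClass x).ncard * (M.cell x y).ncard = (M.typeClass y).ncard * (M.cell y x).ncard := by
  classical
  cases nonempty_fintype V
  simp only [Set.ncard_eq_toFinset_card' (M.typeClass _)]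
  refine Finset.card_mul_eq_card_mul (M.SamePairType M x y) (fun x' hx' => ?_) fun y' hy' => ?_
  · rw [Set.mem_toFinset, mem_typeClass] at hx'
    rw [← hx'.ncard_setOf_samePairType hk, ← Set.ncard_coe_finset]
    congr 1
    ext z
    simp only [Finset.mem_coe, Finset.mem_bipartiteAbove, Set.mem_toFinset, mem_typeClass]
    exact ⟨fun h => h.2, fun h => ⟨h.right, h⟩⟩
  · rw [Set.mem_toFinset, mem_typeClass] at hy'
    rw [← hy'.ncard_setOf_samePairType hk, ← Set.ncard_coe_finset]
    congr 1
    ext z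
    simp only [Finset.mem_coe, Finset.mem_bipartiteBelow, Set.mem_toFinset, mem_typeClass]
    exact ⟨fun h => h.2.swap, fun h => ⟨h.right, h.swap⟩⟩

lemma Exceptional.symm {x y : V} (h : M.Exceptional x y) (hk : s + 1 < k) :
    M.Exceptional y x := by
  have hcount := ncard_typeClass_mul_ncard_cell (M := M) hk x y
  refine Nat.le_of_mul_le_mul_left ?_ (ncard_typeClass_pos (M := M) y)
  calc (M.typeClass y).ncard * (2 * (M.cell y x).ncard)
      = (M.typeClass x).ncard * (2 * (M.cell x y).ncard) := by linarith
    _ ≤ (M.typeClass x).ncard * (M.typeClass y).ncard := Nat.mul_le_mul_left _ h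
    _ = (M.typeClass y).ncard * (M.typeClass x).ncard := mul_comm _ _

lemma SameType.samePairType_of_not_exceptional [Finite W] {x y : V} {x' y' : W}
    (hx : M.SameType N x x') (hy : M.SameType N y y') (hM : ¬ M.Exceptional x y)
    (hN : ¬ N.Exceptional x' y') (hk : s + 1 < k) : M.SamePairType N x y x' y' := by
  obtain ⟨z, hz⟩ := hx.exists_samePairType hk y
  refine hz.trans (cell_eq_iff.1 (cell_eq_of_not_exceptional ?_ ?_ hN))
  · exact typeClass_eq_iff.2 (hz.right.symm.trans hy)
  · rwa [← hz.exceptional_iff hk]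

end PebbledGraph

section Potential

open Finset

variable {V T T' : Type*} [Fintype V] [DecidableEq T'] [DecidableEq T]

/-- The size of the part of the partition of `V` into the fibers of `f` that lies over `t`. -/
def fiberCard (f : V → T) (t : T) : ℕ := #{v | f v = t}

/-- The weight of a part: `L` for its existence and up to `3 * L` for its size. -/
def partWeight (L : ℕ) (f : V → T) (t : T) : ℕ := L + 3 * min (fiberCard f t) L

/-- The total weight of the partition of `V` into the fibers of `f`. -/
def potential (L : ℕ) (f : V → T) : ℕ := ∑ t ∈ univ.image f, partWeight L f t

/-- The parts of the partition into fibers of `g` contained in the part of the coarser `r ∘ g`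
over `t`. -/
def subparts (g : V → T') (r : T' → T) (t : T) : Finset T' := {u ∈ univ.image g | r u = t}

lemma potential_le (L : ℕ) (f : V → T) : potential L f ≤ Fintype.card V * (L + 3) := by
  have hsum : ∑ t ∈ univ.image f, fiberCard f t = Fintype.card V :=
    (card_eq_sum_card_image f univ).symm
  rw [← hsum, sum_mul]
  refine sum_le_sum fun t ht => ?_
  have hpos : 0 < fiberCard f t := by
    obtain ⟨v, -, rfl⟩ := mem_image.1 ht
    exact card_pos.2 ⟨v, by simp⟩
  have hmin := min_le_left (fiberCard f t) L
  rw [partWeight]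
  nlinarith

lemma min_sum_le_sum_min {ι : Type*} (s : Finset ι) (φ : ι → ℕ) (L : ℕ) :
    min (∑ u ∈ s, φ u) L ≤ ∑ u ∈ s, min (φ u) L := by
  classical
  induction s using Finset.induction_on with
  | empty => simp
  | insert a s ha ih => rw [sum_insert ha, sum_insert ha]; omega

variable {g : V → T'} {r : T' → T}

lemma mem_subparts {t : T} {u : T'} : u ∈ subparts g r t ↔ (∃ v, g v = u) ∧ r u = t := by
  simp [subparts]

lemma one_le_card_subparts {t : T} (ht : t ∈ univ.image (r ∘ g)) : 1 ≤ #(subparts g r t) := by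
  obtain ⟨v, -, rfl⟩ := mem_image.1 ht
  exact card_pos.2 ⟨g v, mem_subparts.2 ⟨⟨v, rfl⟩, rfl⟩⟩

lemma sum_sum_subparts (g : V → T') (r : T' → T) (φ : T' → ℕ) :
    ∑ t ∈ univ.image (r ∘ g), ∑ u ∈ subparts g r t, φ u = ∑ u ∈ univ.image g, φ u := by
  rw [← image_image]
  exact sum_fiberwise_of_maps_to (fun u hu => mem_image_of_mem r hu) φ

lemma sum_card_subparts (g : V → T') (r : T' → T) :
    ∑ t ∈ univ.image (r ∘ g), #(subparts g r t) = #(univ.image g) := by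
  simpa only [card_eq_sum_ones] using sum_sum_subparts g r fun _ => 1

lemma sum_fiberCard_subparts (g : V → T') (r : T' → T) (t : T) :
    ∑ u ∈ subparts g r t, fiberCard g u = fiberCard (r ∘ g) t := by
  have hmaps : ∀ v ∈ ({v | (r ∘ g) v = t} : Finset V), g v ∈ subparts g r t := fun v hv =>
    mem_subparts.2 ⟨⟨v, rfl⟩, (mem_filter.1 hv).2⟩
  rw [fiberCard, card_eq_sum_card_fiberwise hmaps]
  refine sum_congr rfl fun u hu => ?_
  rw [fiberCard, filter_filter]
  congr 1
  ext v
  obtain rfl := (mem_subparts.1 hu).2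
  simpa using fun h => congrArg r h

lemma mul_card_subparts_add_le (L : ℕ) (g : V → T') (r : T' → T) (t : T) :
    L * #(subparts g r t) + 3 * min (fiberCard (r ∘ g) t) L ≤
      ∑ u ∈ subparts g r t, partWeight L g u := by
  simp only [partWeight, sum_add_distrib, sum_const, smul_eq_mul, ← mul_sum,
    ← sum_fiberCard_subparts]
  have hmin := min_sum_le_sum_min (subparts g r t) (fiberCard g) L
  rw [mul_comm L]
  omega

lemma partWeight_le_sum_subparts (L : ℕ) {t : T} (ht : t ∈ univ.image (r ∘ g)) :
    partWeight L (r ∘ g) t ≤ ∑ u ∈ subparts g r t, partWeight L g u := by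
  refine le_trans ?_ (mul_card_subparts_add_le L g r t)
  have hone := Nat.mul_le_mul_left L (one_le_card_subparts ht)
  rw [partWeight]
  omega

lemma potential_add_mul_card_image_le (L : ℕ) (g : V → T') (r : T' → T) :
    potential L (r ∘ g) + L * #(univ.image g) ≤ potential L g + L * #(univ.image (r ∘ g)) := by
  rw [← sum_card_subparts g r, potential, potential, ← sum_sum_subparts g r, mul_sum,
    ← sum_add_distrib, mul_comm L #_, ← smul_eq_mul, ← sum_const, ← sum_add_distrib]
  refine sum_le_sum fun t _ => ?_
  have hweight := mul_card_subparts_add_le L g r t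
  rw [partWeight]
  omega

section PotentialLt

variable {L : ℕ} (h : potential L g < potential L (r ∘ g) + 4 * L)

include h

lemma eq_of_potential_lt {v v' : V} (hv : r (g v) = r (g v')) (hLv : L ≤ fiberCard g (g v))
    (hLv' : L ≤ fiberCard g (g v')) : g v = g v' := by
  by_contra hne
  let t := r (g v)
  have ht : t ∈ univ.image (r ∘ g) := mem_image_of_mem _ (mem_univ v)
  have hsub : {g v, g v'} ⊆ subparts g r t := by
    simp [insert_subset_iff, mem_subparts, t, hv]
  have hpair : 8 * L ≤ ∑ u ∈ subparts g r t, partWeight L g u := by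
    refine le_trans (le_of_eq ?_) (sum_le_sum_of_subset hsub)
    rw [sum_pair hne, partWeight, partWeight, min_eq_right hLv, min_eq_right hLv']
    ring
  have hrest := sum_le_sum fun t' (ht' : t' ∈ (univ.image (r ∘ g)).erase t) =>
    partWeight_le_sum_subparts L (mem_of_mem_erase ht')
  have hmin := min_le_right (fiberCard (r ∘ g) t) L
  rw [potential, potential, ← sum_sum_subparts g r, ← add_sum_erase _ _ ht,
    ← add_sum_erase _ _ ht, partWeight] at h
  omega

lemma sum_card_subparts_sub_one_le :
    ∑ t ∈ univ.image (r ∘ g), (#(subparts g r t) - 1) ≤ 3 := by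
  have hcard : #(univ.image g) < #(univ.image (r ∘ g)) + 4 := by
    have hle := potential_add_mul_card_image_le L g r
    refine lt_of_mul_lt_mul_left (a := L) ?_ (Nat.zero_le L)
    linarith
  have hsum : ∑ t ∈ univ.image (r ∘ g), (#(subparts g r t) - 1) + #(univ.image (r ∘ g)) =
      #(univ.image g) := by
    rw [← sum_card_subparts g r, card_eq_sum_ones, ← sum_add_distrib]
    exact sum_congr rfl fun t ht => Nat.sub_add_cancel (one_le_card_subparts ht)
  omega

lemma card_subparts_le (v : V) : #(subparts g r (r (g v))) ≤ 4 := by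
  have hle := (single_le_sum (f := fun t => #(subparts g r t) - 1) (fun _ _ => Nat.zero_le _)
    (mem_image_of_mem (r ∘ g) (mem_univ v))).trans (sum_card_subparts_sub_one_le h)
  exact Nat.sub_le_iff_le_add.1 hle

lemma card_split_le : #{t ∈ univ.image (r ∘ g) | 2 ≤ #(subparts g r t)} ≤ 3 := by
  refine le_trans ?_ (sum_card_subparts_sub_one_le h)
  rw [card_eq_sum_ones, sum_filter]
  refine sum_le_sum fun t _ => ?_
  split_ifs <;> omega

lemma card_split_parts_le : #{u ∈ univ.image g | 2 ≤ #(subparts g r (r u))} ≤ 6 := by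
  refine le_trans ?_ (Nat.mul_le_mul_left 2 (sum_card_subparts_sub_one_le h))
  rw [card_eq_sum_ones, sum_filter, ← sum_sum_subparts g r, mul_sum]
  refine sum_le_sum fun t _ => ?_
  rw [sum_congr rfl fun u hu => by rw [(mem_subparts.1 hu).2], sum_const]
  split_ifs
  · rw [smul_eq_mul]
    omega
  · simp

end PotentialLt

end Potential

lemma ncard_biUnion_le_mul {α ι : Type*} {S : Set ι} (hfin : S.Finite) (f : ι → Set α) {m n : ℕ}
    (hS : S.ncard ≤ n) (hf : ∀ i ∈ S, (f i).ncard ≤ m) : (⋃ i ∈ S, f i).ncard ≤ n * m := by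
  obtain ⟨S, rfl⟩ := hfin.exists_finset_coe
  rw [Set.ncard_coe_finset] at hS
  calc (⋃ i ∈ S, f i).ncard ≤ ∑ i ∈ S, (f i).ncard := S.set_ncard_biUnion_le f
    _ ≤ S.card * m := Finset.sum_le_card_nsmul _ _ _ hf
    _ ≤ n * m := Nat.mul_le_mul_right m hS

namespace PebbledGraph

variable {C : Type w} {V : Type u} {k s L : ℕ} {M : PebbledGraph C V k s}

/-- The graph of the exceptional pairs of distinct vertices. -/
def excGraph (M : PebbledGraph C V k s) : SimpleGraph V := SimpleGraph.fromRel M.Exceptional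

/-- The graph on the types of vertices in which distinct types are linked if they are the types
of the vertices of some exceptional pair. -/
def linkGraph (M : PebbledGraph C V k s) : SimpleGraph (Set V) := M.excGraph.map M.typeClass

open Classical in
/-- No further pebble gains much potential; still, there are enough variables to place more. -/
structure Terminal [Fintype V] (M : PebbledGraph C V k s) (L : ℕ) : Prop where
  room : s + 2 < k
  gain : ∀ x, potential L (M.cell x) < potential L M.typeClass + 4 * L

section

variable [Finite V] [NeZero s]

lemma excGraph_adj (hk : s + 1 < k) {x y : V} :
    M.excGraph.Adj x y ↔ x ≠ y ∧ M.Exceptional x y := by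
  rw [excGraph, SimpleGraph.fromRel_adj]
  exact and_congr_right' (or_iff_left_of_imp fun h => h.symm hk)

lemma linkGraph_adj (hk : s + 1 < k) {X Y : Set V} :
    M.linkGraph.Adj X Y ↔
      X ≠ Y ∧ ∃ x y, M.Exceptional x y ∧ M.typeClass x = X ∧ M.typeClass y = Y := by
  rw [linkGraph, SimpleGraph.map_adj']
  refine and_congr_right fun hne => exists₂_congr fun x y => and_congr_left ?_
  rintro ⟨rfl, rfl⟩
  rw [excGraph_adj hk, and_iff_right fun h => hne (congrArg _ h)]

lemma exists_exceptional_of_linkGraph_adj (hk : s + 1 < k) {x : V} {Y : Set V}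
    (h : M.linkGraph.Adj (M.typeClass x) Y) : ∃ y, M.typeClass y = Y ∧ M.Exceptional x y := by
  obtain ⟨-, x', y', he, hx, rfl⟩ := (linkGraph_adj hk).1 h
  obtain ⟨y, hy⟩ := (typeClass_eq_iff.1 hx).exists_samePairType hk y'
  exact ⟨y, (typeClass_eq_iff.2 hy.right).symm, (hy.exceptional_iff hk).1 he⟩

lemma cell_eq_typeClass_of_typeClass_eq_singleton (hk : s + 1 < k) {x : V}
    (h : M.typeClass x = {x}) (y : V) : M.cell x y = M.typeClass y := by
  refine (cell_subset_typeClass x y).antisymm fun z hz => ?_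
  obtain ⟨x', hx'⟩ := SameType.exists_samePairType hz hk x
  obtain rfl : x' = x := h.subset hx'.right
  exact mem_cell.2 hx'.swap

end

variable [Fintype V]

open Classical in
lemma fiberCard_cell (x y : V) : fiberCard (M.cell x) (M.cell x y) = (M.cell x y).ncard := by
  rw [fiberCard, ← Set.ncard_coe_finset]
  congr 1
  ext z
  simp only [Finset.coe_filter_univ, Set.mem_ofPred_eq]
  rw [eq_comm, cell_eq_iff, mem_cell]

open Classical in
lemma two_le_card_subparts {x y : V} {r : Set V → Set V} (hr : r ∘ M.cell x = M.typeClass)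
    (h : M.cell x y ≠ M.typeClass y) : 2 ≤ (subparts (M.cell x) r (M.typeClass y)).card := by
  obtain ⟨z, hz, hz'⟩ := Set.exists_of_ssubset ((cell_subset_typeClass x y).ssubset_of_ne h)
  have hne : M.cell x y ≠ M.cell x z := fun h => hz' (h ▸ mem_typeClass_self z)
  rw [← Finset.card_pair hne]
  refine Finset.card_le_card (Finset.insert_subset_iff.2 ⟨?_, Finset.singleton_subset_iff.2 ?_⟩)
  · exact mem_subparts.2 ⟨⟨y, rfl⟩, congrFun hr y⟩
  · exact mem_subparts.2 ⟨⟨z, rfl⟩, (congrFun hr z).trans (typeClass_eq_of_mem hz)⟩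

namespace Terminal

variable (hM : M.Terminal L)

include hM

open Classical in
lemma exists_coarsening (x : V) : ∃ r : Set V → Set V, r ∘ M.cell x = M.typeClass ∧
    potential L (M.cell x) < potential L (r ∘ M.cell x) + 4 * L := by
  obtain ⟨r, hr⟩ := exists_comp_cell_eq_typeClass M x
  exact ⟨r, hr, hr ▸ hM.gain x⟩

lemma ncard_split_typeClasses_le (x : V) :
    (M.typeClass '' {y | M.cell x y ≠ M.typeClass y}).ncard ≤ 3 := by
  classical
  obtain ⟨r, hr, hlt⟩ := hM.exists_coarsening x
  refine le_trans ?_ (card_split_le hlt)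
  rw [← Set.ncard_coe_finset]
  refine Set.ncard_le_ncard ?_
  rintro _ ⟨y, hy, rfl⟩
  simp [hr, two_le_card_subparts hr hy]

lemma ncard_split_cells_le (x : V) :
    (M.cell x '' {y | M.cell x y ≠ M.typeClass y}).ncard ≤ 6 := by
  classical
  obtain ⟨r, hr, hlt⟩ := hM.exists_coarsening x
  refine le_trans ?_ (card_split_parts_le hlt)
  rw [← Set.ncard_coe_finset]
  refine Set.ncard_le_ncard ?_
  rintro _ ⟨y, hy, rfl⟩
  have hry : r (M.cell x y) = M.typeClass y := congrFun hr y
  simp [hry, two_le_card_subparts hr hy]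

lemma ncard_cells_le (x y : V) : (M.cell x '' M.typeClass y).ncard ≤ 4 := by
  classical
  obtain ⟨r, hr, hlt⟩ := hM.exists_coarsening x
  refine le_trans ?_ (card_subparts_le hlt y)
  rw [← Set.ncard_coe_finset]
  refine Set.ncard_le_ncard ?_
  rintro _ ⟨z, hz, rfl⟩
  refine mem_subparts.2 ⟨⟨z, rfl⟩, (congrFun hr z).trans ?_⟩
  exact (typeClass_eq_of_mem hz).trans (congrFun hr y).symm

lemma cell_eq_of_le_ncard {x y z : V} (hz : z ∈ M.typeClass y) (hLy : L ≤ (M.cell x y).ncard)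
    (hLz : L ≤ (M.cell x z).ncard) : M.cell x y = M.cell x z := by
  classical
  obtain ⟨r, hr, hlt⟩ := hM.exists_coarsening x
  refine eq_of_potential_lt hlt ?_ ((fiberCard_cell x y).symm ▸ hLy)
    ((fiberCard_cell x z).symm ▸ hLz)
  exact (congrFun hr y).trans ((typeClass_eq_of_mem hz).symm.trans (congrFun hr z).symm)

lemma ncard_cell_le {x y : V} (h : M.Exceptional x y) : (M.cell x y).ncard ≤ 3 * L := by
  by_contra! hlarge
  let S : Set (Set V) := M.cell x '' M.typeClass y \ {M.cell x y}
  have hS : S.ncard ≤ 3 := by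
    have := hM.ncard_cells_le x y
    rw [Set.ncard_sdiff_singleton_of_mem (Set.mem_image_of_mem _ (mem_typeClass_self y))]
    omega
  have hrest : (⋃ c ∈ S, c).ncard ≤ 3 * L := by
    refine ncard_biUnion_le_mul S.toFinite _ hS ?_
    rintro _ ⟨⟨z, hz, rfl⟩, hne⟩
    by_contra! hz'
    exact hne (hM.cell_eq_of_le_ncard hz (by omega) hz'.le).symm
  have hcover : M.typeClass y ⊆ M.cell x y ∪ ⋃ c ∈ S, c := by
    intro z hz
    by_cases hzy : M.cell x z = M.cell x y
    · exact Or.inl (hzy ▸ mem_typeClass_self z)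
    · exact Or.inr (Set.mem_biUnion ⟨⟨z, hz, rfl⟩, hzy⟩ (mem_typeClass_self z))
  have hle := (Set.ncard_le_ncard hcover).trans (Set.ncard_union_le _ _)
  rw [Exceptional] at h
  omega

lemma ncard_setOf_exceptional_le (x : V) : {y | M.Exceptional x y}.ncard ≤ 18 * L := by
  have hcells : (M.cell x '' {y | M.Exceptional x y}).ncard ≤ 6 :=
    (Set.ncard_le_ncard (Set.image_mono fun _ hy => hy.cell_ne_typeClass)).trans
      (hM.ncard_split_cells_le x)
  have hcover : {y | M.Exceptional x y} ⊆ ⋃ c ∈ M.cell x '' {y | M.Exceptional x y}, c :=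
    fun y hy => Set.mem_biUnion (Set.mem_image_of_mem _ hy) (mem_typeClass_self y)
  calc {y | M.Exceptional x y}.ncard
      ≤ 6 * (3 * L) := (Set.ncard_le_ncard hcover).trans
        (ncard_biUnion_le_mul (Set.toFinite _) _ hcells
          (Set.forall_mem_image.2 fun _ hy => hM.ncard_cell_le hy))
    _ = 18 * L := by ring

variable [NeZero s]

lemma ncard_neighborSet_excGraph_le (x : V) : (M.excGraph.neighborSet x).ncard ≤ 18 * L :=
  (Set.ncard_le_ncard fun _ hy => ((excGraph_adj (by have := hM.room; omega)).1 hy).2).trans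
    (hM.ncard_setOf_exceptional_le x)

-- Pebbling `x` splits at most three types. If it splits any other type than that of `x`, it also
-- splits that of `x`.
lemma ncard_neighborSet_linkGraph_le (X : Set V) :
    (M.linkGraph.neighborSet X).ncard ≤ 2 := by
  have hk : s + 1 < k := by have := hM.room; omega
  obtain hX | ⟨Y, hY⟩ := (M.linkGraph.neighborSet X).eq_empty_or_nonempty
  · simp [hX]
  obtain ⟨-, x, y, he, rfl, rfl⟩ := (linkGraph_adj hk).1 hY
  have hx : M.cell x x ≠ M.typeClass x := by
    intro h
    rw [cell_self (by omega)] at h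
    exact he.cell_ne_typeClass (cell_eq_typeClass_of_typeClass_eq_singleton hk h.symm y)
  have hsub : M.linkGraph.neighborSet (M.typeClass x) ⊆
      M.typeClass '' {y | M.cell x y ≠ M.typeClass y} \ {M.typeClass x} := by
    intro Z (hZ : M.linkGraph.Adj _ Z)
    obtain ⟨z, rfl, hz⟩ := exists_exceptional_of_linkGraph_adj hk hZ
    exact ⟨⟨z, hz.cell_ne_typeClass, rfl⟩, hZ.ne.symm⟩
  have hle := Set.ncard_le_ncard hsub
  rw [Set.ncard_sdiff_singleton_of_mem (Set.mem_image_of_mem _ hx)] at hle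
  have := hM.ncard_split_typeClasses_le x
  omega

end Terminal

end PebbledGraph

section Components

variable {V W : Type*} {G : SimpleGraph V} {H : SimpleGraph W}

lemma supp_subset_of_adj_closed {x : V} {S : Set V} (hx : x ∈ S)
    (hS : ∀ y ∈ S, ∀ z, G.Adj y z → z ∈ S) : (G.connectedComponentMk x).supp ⊆ S := by
  have mem_of_walk : ∀ {u v : V}, G.Walk u v → u ∈ S → v ∈ S := by
    intro u v p hu
    induction p with
    | nil => exact hu
    | cons hadj _ ih => exact ih (hS _ hu _ hadj)
  intro y hy
  obtain ⟨p⟩ := (SimpleGraph.ConnectedComponent.exact hy).symm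
  exact mem_of_walk p hx

lemma image_supp_eq [Finite W] {g : V → W} {x₀ : V}
    (hinj : (G.connectedComponentMk x₀).supp.InjOn g)
    (hadj : ∀ x ∈ (G.connectedComponentMk x₀).supp, ∀ y ∈ (G.connectedComponentMk x₀).supp,
      G.Adj x y → H.Adj (g x) (g y))
    (hdeg : ∀ x ∈ (G.connectedComponentMk x₀).supp,
      (G.neighborSet x).ncard = (H.neighborSet (g x)).ncard) :
    g '' (G.connectedComponentMk x₀).supp = (H.connectedComponentMk (g x₀)).supp := by
  set K := (G.connectedComponentMk x₀).supp
  have hx₀ : x₀ ∈ K := rfl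
  have hnbr : ∀ x ∈ K, G.neighborSet x ⊆ K :=
    fun x hx y hy => (SimpleGraph.ConnectedComponent.mem_supp_congr_adj _ hy).1 hx
  refine Set.Subset.antisymm ?_ (supp_subset_of_adj_closed ⟨x₀, hx₀, rfl⟩ ?_)
  · have hsub : K ⊆ K ∩ g ⁻¹' (H.connectedComponentMk (g x₀)).supp := by
      refine supp_subset_of_adj_closed ⟨hx₀, rfl⟩ fun y hy z hyz => ?_
      have hz := hnbr y hy.1 hyz
      exact ⟨hz, (SimpleGraph.ConnectedComponent.mem_supp_congr_adj _
        (hadj y hy.1 z hz hyz)).1 hy.2⟩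
    exact Set.image_subset_iff.2 (hsub.trans Set.inter_subset_right)
  · rintro _ ⟨x, hx, rfl⟩ y hy
    have himage : g '' G.neighborSet x = H.neighborSet (g x) := by
      refine Set.eq_of_subset_of_ncard_le ?_ ?_
      · rintro _ ⟨z, hz, rfl⟩
        exact hadj x hx z (hnbr x hx hz) hz
      · rw [← hdeg x hx, (hinj.mono (hnbr x hx)).ncard_image]
    exact Set.image_mono (hnbr x hx) (himage.symm.subset hy)

end Components

section Cut

variable {α : Type*} {G : SimpleGraph α} {Q : Set α} {X Y : α}

/-- The edges leaving `Q`, directed away from `Q`. -/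
def cut (G : SimpleGraph α) (Q : Set α) : Set (α × α) := {z | z.1 ∈ Q ∧ z.2 ∉ Q ∧ G.Adj z.1 z.2}

variable [Finite α]

lemma ncard_cut_singleton_le (X : α) : (cut G {X}).ncard ≤ (G.neighborSet X).ncard := by
  refine (Set.ncard_le_ncard (t := Prod.mk X '' G.neighborSet X) ?_).trans Set.ncard_image_le
  rintro ⟨A, B⟩ ⟨hA, -, hAB⟩
  obtain rfl : A = X := hA
  exact ⟨B, hAB, rfl⟩

-- The edge `XY` ceases to leave `Q`, in exchange for at most one further edge at `Y`.
lemma ncard_cut_insert_le (hX : X ∈ Q) (hY : Y ∉ Q) (hXY : G.Adj X Y)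
    (hdeg : (G.neighborSet Y).ncard ≤ 2) : (cut G (insert Y Q)).ncard ≤ (cut G Q).ncard := by
  have hmem : (X, Y) ∈ cut G Q := ⟨hX, hY, hXY⟩
  have hsub : cut G (insert Y Q) ⊆
      cut G Q \ {(X, Y)} ∪ Prod.mk Y '' (G.neighborSet Y \ {X}) := by
    rintro ⟨A, B⟩ ⟨hA | hA, hB, hAB⟩
    all_goals simp only [Set.mem_insert_iff, not_or] at hA hB hAB
    · subst hA
      exact Or.inr ⟨B, ⟨hAB, fun h => hB.2 (h ▸ hX)⟩, rfl⟩
    · exact Or.inl ⟨⟨hA, hB.2, hAB⟩, fun h => hB.1 (congrArg Prod.snd h)⟩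
  have hle := (Set.ncard_le_ncard hsub).trans (Set.ncard_union_le _ _)
  have himage : (Prod.mk Y '' (G.neighborSet Y \ {X})).ncard ≤ _ := Set.ncard_image_le
  rw [Set.ncard_sdiff_singleton_of_mem hmem] at hle
  rw [Set.ncard_sdiff_singleton_of_mem (show X ∈ G.neighborSet Y from hXY.symm)] at himage
  have hpos : 0 < (cut G Q).ncard := (Set.ncard_pos (Set.toFinite _)).2 ⟨_, hmem⟩
  omega

end Cut

section ClosedBall

variable {V T : Type*}

/-- The vertices at distance at most `r` from `x`. -/
def closedBall (G : SimpleGraph V) (x : V) (r : ℕ) : Set V := {y | G.edist x y ≤ r}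

variable {G : SimpleGraph V} {x y : V} {r : ℕ}

lemma closedBall_zero : closedBall G x 0 = {x} := by
  ext y
  simp [closedBall, eq_comm (a := x)]

lemma closedBall_mono {r' : ℕ} (h : r ≤ r') : closedBall G x r ⊆ closedBall G x r' :=
  fun y (hy : G.edist x y ≤ r) => show G.edist x y ≤ r' from hy.trans (Nat.cast_le.2 h)

lemma mem_closedBall_comm : y ∈ closedBall G x r ↔ x ∈ closedBall G y r := by
  rw [closedBall, closedBall, Set.mem_ofPred_eq, Set.mem_ofPred_eq, SimpleGraph.edist_comm]

lemma mem_closedBall_succ :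
    y ∈ closedBall G x (r + 1) ↔ ∃ z ∈ closedBall G x r, z = y ∨ G.Adj z y := by
  constructor
  · intro h
    have hle : G.edist y x ≤ ((r + 1 : ℕ) : ℕ∞) := mem_closedBall_comm.1 h
    obtain ⟨p, hp⟩ := SimpleGraph.exists_walk_of_edist_ne_top (ne_top_of_le_ne_top
      (ENat.natCast_ne_top _) hle)
    rw [← hp] at hle
    cases p with
    | nil => exact ⟨x, by simp [closedBall], Or.inl rfl⟩
    | cons hadj q =>
      refine ⟨_, mem_closedBall_comm.1 (q.edist_le.trans ?_), Or.inr hadj.symm⟩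
      rw [SimpleGraph.Walk.length_cons] at hle
      exact_mod_cast Nat.le_of_succ_le_succ (by exact_mod_cast hle)
  · rintro ⟨z, hz, hzy⟩
    calc G.edist x y ≤ G.edist x z + G.edist z y := G.edist_triangle
      _ ≤ r + 1 := add_le_add hz (SimpleGraph.edist_le_one_iff_adj_or_eq.2 hzy.symm)
      _ = ((r + 1 : ℕ) : ℕ∞) := by norm_cast

lemma ncard_closedBall_le [Finite V] {d : ℕ} (hd : ∀ z, (G.neighborSet z).ncard ≤ d) (x : V)
    (r : ℕ) : (closedBall G x r).ncard ≤ (d + 1) ^ r := by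
  induction r with
  | zero => simp [closedBall_zero]
  | succ r ih =>
    have hsub : closedBall G x (r + 1) ⊆
        ⋃ z ∈ closedBall G x r, insert z (G.neighborSet z) := by
      intro y hy
      obtain ⟨z, hz, hzy⟩ := mem_closedBall_succ.1 hy
      exact Set.mem_biUnion hz (hzy.imp_left Eq.symm)
    rw [pow_succ]
    refine (Set.ncard_le_ncard hsub).trans (ncard_biUnion_le_mul (Set.toFinite _) _ ih ?_)
    exact fun z _ => (Set.ncard_insert_le _ _).trans (Nat.succ_le_succ (hd z))

lemma supp_subset_closedBall (h : closedBall G x (r + 1) = closedBall G x r) :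
    (G.connectedComponentMk x).supp ⊆ closedBall G x r := by
  refine supp_subset_of_adj_closed (closedBall_mono r.zero_le (by simp [closedBall_zero])) ?_
  exact fun y hy z hyz => h.subset (mem_closedBall_succ.2 ⟨y, hy, Or.inr hyz⟩)

lemma supp_subset_closedBall_of_ncard_image_le [Finite V] {f : V → T} {n : ℕ}
    (hn : (f '' closedBall G x n).ncard ≤ n)
    (hf : ∀ r y z, f y = f z → y ∈ closedBall G x r → z ∈ closedBall G x r) :
    (G.connectedComponentMk x).supp ⊆ closedBall G x n := by
  suffices ∃ r < n, closedBall G x (r + 1) = closedBall G x r by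
    obtain ⟨r, hr, heq⟩ := this
    exact (supp_subset_closedBall heq).trans (closedBall_mono hr.le)
  by_contra! hgrow
  have hlt : ∀ r ≤ n, r < (f '' closedBall G x r).ncard := by
    intro r hr
    induction r with
    | zero => simp [closedBall_zero]
    | succ r ih =>
      refine (Nat.succ_le_of_lt (ih (by omega))).trans_lt (Set.ncard_lt_ncard ?_)
      refine (Set.image_mono (closedBall_mono r.le_succ)).ssubset_of_ne fun heq => ?_
      refine hgrow r hr (Set.Subset.antisymm (fun y hy => ?_) (closedBall_mono r.le_succ))
      obtain ⟨z, hz, hzy⟩ := heq.symm.subset (Set.mem_image_of_mem f hy)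
      exact hf r z y hzy hz
  exact (hlt n le_rfl).not_ge hn

end ClosedBall

namespace PebbledGraph

variable {C : Type w} {V : Type u} {W : Type v} {k s L : ℕ}
variable {M : PebbledGraph C V k s} {N : PebbledGraph C W k s}

section ComponentSize

variable [NeZero s]

lemma SamePairType.excGraph_adj_iff [Finite V] [Finite W] {x y : V} {x' y' : W}
    (h : M.SamePairType N x y x' y') (hk : s + 1 < k) :
    M.excGraph.Adj x y ↔ N.excGraph.Adj x' y' := by
  rw [excGraph_adj hk, excGraph_adj hk, Ne, h.eq_iff (by omega), h.exceptional_iff hk]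

lemma SamePairType.mem_closedBall [Finite V] [Finite W] {x y : V} {x' y' : W}
    (h : M.SamePairType N x y x' y') (hk : s + 2 < k) {r : ℕ}
    (hy : y ∈ closedBall M.excGraph x r) : y' ∈ closedBall N.excGraph x' r := by
  induction r generalizing y y' with
  | zero =>
    rw [closedBall_zero, Set.mem_singleton_iff] at hy ⊢
    exact ((h.eq_iff (by omega)).1 hy.symm).symm
  | succ r ih =>
    obtain ⟨z, hz, hzy⟩ := mem_closedBall_succ.1 hy
    obtain ⟨z', hxz, hzy'⟩ := h.exists_samePairType hk z
    refine mem_closedBall_succ.2 ⟨z', ih hxz hz, hzy.imp ?_ ?_⟩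
    · exact (hzy'.eq_iff (by omega)).1
    · exact (hzy'.excGraph_adj_iff (by omega)).1

/-- A bound for the number of vertices of any one type in a component of the graph of
exceptional pairs: the exponent is twice the radius `6`, which is the number of cells that the
types split by pebbling a vertex can fall into. -/
def compBound (L : ℕ) : ℕ := (18 * L + 1) ^ 12

variable [Fintype V]

lemma Terminal.ncard_closedBall_le (hM : M.Terminal L) (x : V) (r : ℕ) :
    (closedBall M.excGraph x r).ncard ≤ (18 * L + 1) ^ r :=
  _root_.ncard_closedBall_le hM.ncard_neighborSet_excGraph_le x r

lemma Terminal.ncard_supp_le (hM : M.Terminal L) {x : V}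
    (h : ∀ y ∈ closedBall M.excGraph x 6, M.cell x y ≠ M.typeClass y) :
    (M.excGraph.connectedComponentMk x).supp.ncard ≤ (18 * L + 1) ^ 6 := by
  refine (Set.ncard_le_ncard ?_).trans (hM.ncard_closedBall_le x 6)
  refine supp_subset_closedBall_of_ncard_image_le (f := M.cell x) ?_ ?_
  · exact (Set.ncard_le_ncard (Set.image_mono h)).trans (hM.ncard_split_cells_le x)
  · exact fun r y z hyz => (cell_eq_iff.1 hyz).mem_closedBall hM.room

lemma Terminal.ncard_typeClass_le (hM : M.Terminal L) {x y : V}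
    (hy : y ∈ closedBall M.excGraph x 6) (h : M.cell x y = M.typeClass y) :
    (M.typeClass x).ncard ≤ (18 * L + 1) ^ 12 := by
  have hk := hM.room
  have hY : (M.typeClass y).ncard ≤ (18 * L + 1) ^ 6 := by
    rw [← h]
    refine (Set.ncard_le_ncard fun t ht => ?_).trans (hM.ncard_closedBall_le x 6)
    exact (mem_cell.1 ht).mem_closedBall hk hy
  have hcover : M.typeClass x ⊆ ⋃ t ∈ M.typeClass y, closedBall M.excGraph t 6 := by
    intro x' hx'
    obtain ⟨t, ht⟩ := SameType.exists_samePairType hx' (by omega) y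
    exact Set.mem_biUnion ht.right (mem_closedBall_comm.1 (ht.mem_closedBall hk hy))
  rw [show 12 = 6 + 6 from rfl, pow_add]
  exact (Set.ncard_le_ncard hcover).trans (ncard_biUnion_le_mul (Set.toFinite _) _ hY
    fun t _ => hM.ncard_closedBall_le t 6)

lemma Terminal.ncard_supp_inter_typeClass_le (hM : M.Terminal L)
    (K : M.excGraph.ConnectedComponent) (x : V) :
    (K.supp ∩ M.typeClass x).ncard ≤ compBound L := by
  obtain h | ⟨z, rfl, hz⟩ := (K.supp ∩ M.typeClass x).eq_empty_or_nonempty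
  · simp [h]
  rw [← typeClass_eq_of_mem hz, compBound]
  by_cases h : ∀ y ∈ closedBall M.excGraph z 6, M.cell z y ≠ M.typeClass y
  · refine (Set.ncard_le_ncard Set.inter_subset_left).trans ((hM.ncard_supp_le h).trans ?_)
    exact Nat.pow_le_pow_right (by omega) (by norm_num)
  · push Not at h
    obtain ⟨y, hy, hcell⟩ := h
    exact (Set.ncard_le_ncard Set.inter_subset_right).trans (hM.ncard_typeClass_le hy hcell)

end ComponentSize

lemma Sim.exists_extend [Finite V] [Finite W] [NeZero s] {g : V → W} {S : Set V}
    (h : M.Sim N (S.graphOn g)) (T : Set V) (hST : Disjoint S T)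
    (hk : s + S.ncard + T.ncard ≤ k) :
    ∃ g' : V → W, Tᶜ.EqOn g' g ∧ M.Sim N ((S ∪ T).graphOn g') := by
  classical
  induction T, T.toFinite using Set.Finite.induction_on with
  | empty => exact ⟨g, fun _ _ => rfl, by simpa using h⟩
  | @insert a T ha hT ih =>
    rw [Set.ncard_insert_of_notMem ha hT] at hk
    rw [Set.disjoint_insert_right] at hST
    obtain ⟨g', hg, hsim⟩ := ih hST.2 (by omega)
    have hcard : ((S ∪ T).graphOn g').ncard ≤ S.ncard + T.ncard :=
      (Set.ncard_image_le (Set.toFinite _)).trans (Set.ncard_union_le _ _)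
    obtain ⟨y, hy⟩ := hsim.exists_pair (by omega) a
    have haST : a ∉ S ∪ T := fun h => h.elim hST.1 ha
    refine ⟨Function.update g' a y, fun x hx => ?_, ?_⟩
    · rw [Set.mem_compl_iff, Set.mem_insert_iff, not_or] at hx
      rw [Function.update_of_ne hx.1, hg hx.2]
    · have heq : (S ∪ T).EqOn (Function.update g' a y) g' := fun x hx =>
        Function.update_of_ne (ne_of_mem_of_not_mem hx haST) _ _
      rwa [Set.union_insert, Set.graphOn_insert, Function.update_self, Set.graphOn_inj.2 heq]

lemma Sim.samePairType_of_graphOn {S : Set V} {g : V → W} (h : M.Sim N (S.graphOn g)) {x y : V}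
    (hx : x ∈ S) (hy : y ∈ S) : M.SamePairType N x y (g x) (g y) := by
  refine Sim.mono h ?_
  simp [Set.insert_subset_iff, hx, hy]

/-- The types of `x` and `y` are equal or linked. -/
def Near (M : PebbledGraph C V k s) (x y : V) : Prop :=
  M.typeClass x = M.typeClass y ∨ M.linkGraph.Adj (M.typeClass x) (M.typeClass y)

lemma Near.symm {x y : V} (h : M.Near x y) : M.Near y x := h.imp Eq.symm SimpleGraph.Adj.symm

lemma Exceptional.near [Finite V] [NeZero s] {x y : V} (h : M.Exceptional x y)
    (hk : s + 1 < k) : M.Near x y := by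
  by_cases heq : M.typeClass x = M.typeClass y
  · exact Or.inl heq
  · exact Or.inr ((linkGraph_adj hk).2 ⟨heq, x, y, h, rfl, rfl⟩)

/-- The vertices of a component of the graph of exceptional pairs whose type is in `Q` and linked
to a type outside `Q`. -/
def boundary (M : PebbledGraph C V k s) (K : M.excGraph.ConnectedComponent) (Q : Set (Set V)) :
    Set V :=
  {x | x ∈ K.supp ∧ M.typeClass x ∈ Q ∧ ∃ Y, Y ∉ Q ∧ M.linkGraph.Adj (M.typeClass x) Y}

/-- Duplicator has answered `x` with `g x` for all vertices `x` of a component of the graph of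
exceptional pairs that have a type in `Q`, and only the pebbles on the boundary have to stay. -/
structure Explores (M : PebbledGraph C V k s) (N : PebbledGraph C W k s)
    (K : M.excGraph.ConnectedComponent) (Q : Set (Set V)) (g : V → W) : Prop where
  sim_boundary : M.Sim N ((M.boundary K Q).graphOn g)
  samePairType : ∀ x ∈ K.supp, ∀ y ∈ K.supp, M.typeClass x ∈ Q → M.typeClass y ∈ Q →
    M.Near x y → M.SamePairType N x y (g x) (g y)

lemma boundary_insert_subset (K : M.excGraph.ConnectedComponent) (Q : Set (Set V)) (Y : Set V) :
    M.boundary K (insert Y Q) ⊆ M.boundary K Q ∪ K.supp ∩ {x | M.typeClass x = Y} := by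
  rintro x ⟨hx, hxY | hxQ, Z, hZ, hl⟩
  · exact Or.inr ⟨hx, hxY⟩
  · exact Or.inl ⟨hx, hxQ, Z, fun h => hZ (Or.inr h), hl⟩

section Explore

variable [Fintype V] [NeZero s] {K : M.excGraph.ConnectedComponent} {Q : Set (Set V)}
variable (hM : M.Terminal L)

include hM

namespace Terminal

lemma ncard_supp_inter_setOf_typeClass_eq_le (K : M.excGraph.ConnectedComponent) (X : Set V) :
    (K.supp ∩ {x | M.typeClass x = X}).ncard ≤ compBound L := by
  obtain h | ⟨z, -, rfl⟩ := (K.supp ∩ {x | M.typeClass x = X}).eq_empty_or_nonempty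
  · simp [h]
  · refine (Set.ncard_le_ncard ?_).trans (hM.ncard_supp_inter_typeClass_le K z)
    exact Set.inter_subset_inter_right _ fun y hy => typeClass_eq_iff.1 (Eq.symm hy)

lemma ncard_boundary_le (K : M.excGraph.ConnectedComponent) (Q : Set (Set V)) :
    (M.boundary K Q).ncard ≤ (cut M.linkGraph Q).ncard * compBound L := by
  have hcover : M.boundary K Q ⊆
      ⋃ z ∈ cut M.linkGraph Q, K.supp ∩ {x | M.typeClass x = z.1} := by
    rintro x ⟨hx, hxQ, Y, hY, hl⟩
    exact Set.mem_biUnion (show (M.typeClass x, Y) ∈ cut M.linkGraph Q from ⟨hxQ, hY, hl⟩)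
      ⟨hx, rfl⟩
  exact (Set.ncard_le_ncard hcover).trans (ncard_biUnion_le_mul (Set.toFinite _) _ le_rfl
    fun z _ => hM.ncard_supp_inter_setOf_typeClass_eq_le K z.1)

variable [Finite W]

lemma exists_explores_singleton {x₀ : V} {y₀ : W} (h : M.SameType N x₀ y₀)
    (K : M.excGraph.ConnectedComponent) (hk : s + 1 + compBound L ≤ k) :
    ∃ g, g x₀ = y₀ ∧ M.Explores N K {M.typeClass x₀} g := by
  let T := K.supp ∩ {x | M.typeClass x = M.typeClass x₀}
  have hT : (T \ {x₀}).ncard ≤ compBound L := (Set.ncard_le_ncard Set.sdiff_subset).trans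
    (hM.ncard_supp_inter_setOf_typeClass_eq_le K (M.typeClass x₀))
  have hsim : M.Sim N (({x₀} : Set V).graphOn fun _ => y₀) := by
    rw [Set.graphOn_singleton]
    exact h
  obtain ⟨g, hg, hsimg⟩ := hsim.exists_extend (T \ {x₀}) Set.disjoint_sdiff_right
    (by rw [Set.ncard_singleton]; omega)
  have hTsub : T ⊆ {x₀} ∪ T \ {x₀} := by rw [Set.union_sdiff_self]; exact Set.subset_union_right
  refine ⟨g, hg (by simp), ⟨hsimg.mono (Set.image_mono fun x hx => ?_), ?_⟩⟩
  · exact hTsub ⟨hx.1, hx.2.1⟩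
  · exact fun x hx y hy hxQ hyQ _ =>
      hsimg.samePairType_of_graphOn (hTsub ⟨hx, hxQ⟩) (hTsub ⟨hy, hyQ⟩)

lemma exists_explores_insert {x₀ : V} {g : V → W} (hg : M.Explores N K Q g) {Y : Set V}
    (hx₀ : M.typeClass x₀ ∈ Q) (hY : Y ∉ Q) (hcut : (cut M.linkGraph Q).ncard ≤ 2)
    (hk : s + 3 * compBound L ≤ k) : ∃ g', g' x₀ = g x₀ ∧ M.Explores N K (insert Y Q) g' := by
  let T := K.supp ∩ {x | M.typeClass x = Y}
  have hT : T.ncard ≤ compBound L := hM.ncard_supp_inter_setOf_typeClass_eq_le K Y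
  have hdisj : Disjoint (M.boundary K Q) T :=
    Set.disjoint_left.2 fun x hx hxT => hY (hxT.2 ▸ hx.2.1)
  have hboundary : (M.boundary K Q).ncard ≤ 2 * compBound L :=
    (hM.ncard_boundary_le K Q).trans (Nat.mul_le_mul_right _ hcut)
  obtain ⟨g', hg', hsim⟩ := hg.sim_boundary.exists_extend T hdisj (by omega)
  have hold : ∀ x, M.typeClass x ∈ Q → g' x = g x := fun x hx =>
    hg' fun hxT => hY (hxT.2 ▸ hx)
  have hnew : ∀ x ∈ K.supp, ∀ y ∈ K.supp, M.typeClass x ∈ insert Y Q → M.typeClass y = Y →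
      M.Near x y → M.SamePairType N x y (g' x) (g' y) := by
    rintro x hx y hy hxQ rfl hxy
    refine hsim.samePairType_of_graphOn ?_ (Or.inr ⟨hy, rfl⟩)
    obtain hxY | hl := hxy
    · exact Or.inr ⟨hx, hxY⟩
    · exact Or.inl ⟨hx, hxQ.resolve_left hl.ne, _, hY, hl⟩
  refine ⟨g', hold x₀ hx₀, hsim.mono (Set.image_mono (boundary_insert_subset K Q Y)), ?_⟩
  rintro x hx y hy hxQ (hyY | hyQ) hxy
  · exact hnew x hx y hy hxQ hyY hxy
  obtain hxY | hxQ := hxQ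
  · exact (hnew y hy x hx (Or.inr hyQ) hxY hxy.symm).swap
  · rw [hold x hxQ, hold y hyQ]
    exact hg.samePairType x hx y hy hxQ hyQ hxy

lemma exists_explores_supp {x₀ : V} {y₀ : W} (h : M.SameType N x₀ y₀)
    (hk : s + 3 * compBound L ≤ k) : ∃ Q g, g x₀ = y₀ ∧
      M.Explores N (M.excGraph.connectedComponentMk x₀) Q g ∧
      ∀ x ∈ (M.excGraph.connectedComponentMk x₀).supp, M.typeClass x ∈ Q := by
  have hk' : s + 1 < k := by have := hM.room; omega
  have hpos : 1 ≤ compBound L := Nat.one_le_pow _ _ (by omega)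
  let K := M.excGraph.connectedComponentMk x₀
  let p : Set (Set V) → Prop := fun Q => M.typeClass x₀ ∈ Q ∧ (cut M.linkGraph Q).ncard ≤ 2 ∧
    ∃ g, g x₀ = y₀ ∧ M.Explores N K Q g
  have hp : p {M.typeClass x₀} := ⟨rfl, (ncard_cut_singleton_le _).trans
    (hM.ncard_neighborSet_linkGraph_le _), hM.exists_explores_singleton h K (by omega)⟩
  obtain ⟨Q, -, ⟨hx₀, hcut, g, rfl, hg⟩, hmax⟩ := Finite.exists_le_maximal hp
  have hclosed : ∀ X ∈ Q, ∀ Y, M.linkGraph.Adj X Y → Y ∈ Q := by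
    intro X hX Y hXY
    by_contra hY
    have hpY : p (insert Y Q) := ⟨Or.inr hx₀, (ncard_cut_insert_le hX hY hXY
      (hM.ncard_neighborSet_linkGraph_le Y)).trans hcut,
      hM.exists_explores_insert hg hx₀ hY hcut hk⟩
    exact hY (hmax hpY (Set.subset_insert Y Q) (Set.mem_insert Y Q))
  refine ⟨Q, g, rfl, hg, ?_⟩
  refine supp_subset_of_adj_closed (S := {x | M.typeClass x ∈ Q}) hx₀ fun y hy z hyz => ?_
  obtain heq | hl := ((excGraph_adj hk').1 hyz).2.near hk'
  · exact show M.typeClass z ∈ Q from heq ▸ hy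
  · exact hclosed _ hy _ hl

lemma exists_samePairType_on_supp {x₀ : V} {y₀ : W} (h : M.SameType N x₀ y₀)
    (hk : s + 3 * compBound L ≤ k) : ∃ g : V → W, g x₀ = y₀ ∧
      ∀ x ∈ (M.excGraph.connectedComponentMk x₀).supp,
        ∀ y ∈ (M.excGraph.connectedComponentMk x₀).supp,
          M.SamePairType N x y (g x) (g y) := by
  have hk' : s + 1 < k := by have := hM.room; omega
  obtain ⟨Q, g, hg₀, hg, hQ⟩ := hM.exists_explores_supp h hk
  refine ⟨g, hg₀, fun x hx y hy => ?_⟩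
  by_cases hxy : M.Near x y
  · exact hg.samePairType x hx y hy (hQ x hx) (hQ y hy) hxy
  have hgx := (hg.samePairType x hx x hx (hQ x hx) (hQ x hx) (Or.inl rfl)).left
  have hgy := (hg.samePairType y hy y hy (hQ y hy) (hQ y hy) (Or.inl rfl)).left
  refine hgx.samePairType_of_not_exceptional hgy (fun he => hxy (he.near hk'))
    (fun he => hxy ?_) hk'
  obtain ⟨y', hy'⟩ := hgx.symm.exists_samePairType hk' (g y)
  have hnear := ((hy'.exceptional_iff hk').1 he).near hk'
  rwa [Near, ← typeClass_eq_iff.2 (hgy.trans hy'.right)] at hnear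

end Terminal

end Explore

end PebbledGraph

section Matching

variable {V W α β T : Type*} [Finite V] [Finite W]

lemma ncard_setOf_comp_eq_mul {c : V → α} {F : α → T} {t : T} {m : ℕ} (hc : c.Surjective)
    (hm : ∀ a, F a = t → {x | c x = a}.ncard = m) :
    {x | F (c x) = t}.ncard = {a | F a = t}.ncard * m := by
  classical
  have := Finite.of_surjective c hc
  cases nonempty_fintype V
  cases nonempty_fintype α
  have hmaps : ∀ x ∈ ({x | F (c x) = t} : Finset V), c x ∈ ({a | F a = t} : Finset α) := by simp
  simp only [Set.ncard_eq_toFinset_card', Set.toFinset_ofPred]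
  rw [Finset.card_eq_sum_card_fiberwise hmaps, Finset.sum_const_nat fun a ha => ?_]
  have ha : F a = t := by simpa using ha
  rw [← hm a ha, Set.ncard_eq_toFinset_card', Set.toFinset_ofPred, Finset.filter_filter]
  congr 1
  ext x
  simp only [Finset.mem_filter_univ, and_iff_right_iff_imp]
  rintro rfl
  exact ha

lemma exists_equiv_of_ncard_fiber_eq {c : V → α} {d : W → β} (hc : c.Surjective)
    (hd : d.Surjective) {F : α → T} {G : β → T} (f : V ≃ W) (hf : ∀ x, G (d (f x)) = F (c x))
    (hcard : ∀ a b, F a = G b → {x | c x = a}.ncard = {y | d y = b}.ncard) :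
    ∃ π : α ≃ β, ∀ a, G (π a) = F a := by
  have := Finite.of_surjective c hc
  have := Finite.of_surjective d hd
  refine exists_equiv_of_ncard_eq F G fun t => ?_
  have hpreimage : {x | F (c x) = t}.ncard = {y | G (d y) = t}.ncard := by
    simp only [← hf]
    exact Set.ncard_preimage_of_injective_subset_range (s := {y | G (d y) = t}) f.injective
      (by simp)
  by_cases ht : ∃ x, F (c x) = t
  · obtain ⟨x, rfl⟩ := ht
    have hm : 0 < {x' | c x' = c x}.ncard := (Set.ncard_pos (Set.toFinite _)).2 ⟨x, rfl⟩
    rw [ncard_setOf_comp_eq_mul hc fun a ha =>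
        (hcard a _ (ha.trans (hf x).symm)).trans (hcard _ _ (hf x).symm).symm,
      ncard_setOf_comp_eq_mul hd fun b hb => (hcard (c x) b hb.symm).symm] at hpreimage
    exact Nat.eq_of_mul_eq_mul_right hm hpreimage
  · have hF : ∀ a, F a ≠ t := hc.forall.2 fun x hx => ht ⟨x, hx⟩
    have hG : ∀ b, G b ≠ t := hd.forall.2 <| f.surjective.forall.2 fun x hx =>
      ht ⟨x, (hf x).symm.trans hx⟩
    simp [hF, hG]

end Matching

namespace PebbledGraph

variable {C : Type w} {V : Type u} {W : Type v} {k s L : ℕ}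
variable {M : PebbledGraph C V k s} {N : PebbledGraph C W k s}

/-- `g` restricts to a bijection between two components of the graphs of exceptional pairs that
preserves the types of pairs of vertices. -/
structure IsComponentIso (M : PebbledGraph C V k s) (N : PebbledGraph C W k s)
    (K : M.excGraph.ConnectedComponent) (J : N.excGraph.ConnectedComponent) (g : V → W) :
    Prop where
  samePairType : ∀ x ∈ K.supp, ∀ y ∈ K.supp, M.SamePairType N x y (g x) (g y)
  image_supp : g '' K.supp = J.supp

/-- The vertices of `N` that have the type of some vertex of the component `K`. -/
def metTypes (M : PebbledGraph C V k s) (N : PebbledGraph C W k s)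
    (K : M.excGraph.ConnectedComponent) : Set W :=
  {y | ∃ x ∈ K.supp, M.SameType N x y}

section ComponentIso

variable {K : M.excGraph.ConnectedComponent} {K' : N.excGraph.ConnectedComponent} {g : V → W}

lemma IsComponentIso.ncard_supp_eq (h : M.IsComponentIso N K K' g) (hk : 1 < k) :
    K.supp.ncard = K'.supp.ncard := by
  have hinj : K.supp.InjOn g := fun x hx y hy hxy => ((h.samePairType x hx y hy).eq_iff hk).2 hxy
  rw [← h.image_supp, hinj.ncard_image]

lemma IsComponentIso.metTypes_eq (h : M.IsComponentIso N K K' g) :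
    M.metTypes N K = N.metTypes N K' := by
  ext y
  constructor
  · rintro ⟨x, hx, hxy⟩
    exact ⟨g x, h.image_supp.subset ⟨x, hx, rfl⟩, (h.samePairType x hx x hx).left.symm.trans hxy⟩
  · rintro ⟨z, hz, hzy⟩
    obtain ⟨x, hx, rfl⟩ := h.image_supp.superset hz
    exact ⟨x, hx, (h.samePairType x hx x hx).left.trans hzy⟩

end ComponentIso

variable [NeZero s]

lemma SameType.ncard_neighborSet_eq [Finite V] [Finite W] {x : V} {x' : W}
    (h : M.SameType N x x') (hk : s + 1 < k) :
    (M.excGraph.neighborSet x).ncard = (N.excGraph.neighborSet x').ncard := by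
  obtain ⟨f, hf⟩ := h.exists_equiv_samePairType hk
  have hpreimage : f ⁻¹' N.excGraph.neighborSet x' = M.excGraph.neighborSet x :=
    Set.ext fun z => ((hf z).excGraph_adj_iff hk).symm
  rw [← hpreimage, Set.ncard_preimage_of_injective_subset_range f.injective (by simp)]

lemma Exceptional.connectedComponentMk_eq [Finite V] {x y : V} (h : M.Exceptional x y)
    (hk : s + 1 < k) : M.excGraph.connectedComponentMk x = M.excGraph.connectedComponentMk y := by
  obtain rfl | hxy := eq_or_ne x y
  · rfl
  · exact SimpleGraph.ConnectedComponent.sound ((excGraph_adj hk).2 ⟨hxy, h⟩).reachable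

variable [Fintype V] [Finite W]

namespace Terminal

variable (hM : M.Terminal L) (hk : s + 3 * compBound L ≤ k)

include hM hk

lemma exists_isComponentIso {x : V} {y : W} (h : M.SameType N x y) :
    ∃ g, M.IsComponentIso N (M.excGraph.connectedComponentMk x)
      (N.excGraph.connectedComponentMk y) g := by
  have hk' : s + 1 < k := by have := hM.room; omega
  obtain ⟨g, rfl, hg⟩ := hM.exists_samePairType_on_supp h hk
  refine ⟨g, hg, image_supp_eq (fun z hz z' hz' hzz' => ?_) (fun z hz z' hz' => ?_)
    fun z hz => (hg z hz z hz).left.ncard_neighborSet_eq hk'⟩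
  · exact ((hg z hz z' hz').eq_iff (by omega)).2 hzz'
  · exact ((hg z hz z' hz').excGraph_adj_iff hk').1

lemma exists_isComponentIso_of_metTypes_eq (hMN : M.Sim N ∅)
    {K : M.excGraph.ConnectedComponent} {K' : N.excGraph.ConnectedComponent}
    (h : M.metTypes N K = N.metTypes N K') : ∃ g, M.IsComponentIso N K K' g := by
  obtain ⟨x, rfl⟩ := K.exists_rep
  obtain ⟨f, hf⟩ := hMN.exists_equiv_sameType (by have := hM.room; omega)
  obtain ⟨y, rfl, hy⟩ := h.subset ⟨x, rfl, hf x⟩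
  exact hM.exists_isComponentIso hk ((hf x).trans hy.symm)

lemma exists_equiv_isComponentIso (hMN : M.Sim N ∅) :
    ∃ (π : M.excGraph.ConnectedComponent ≃ N.excGraph.ConnectedComponent)
      (g : M.excGraph.ConnectedComponent → V → W), ∀ K, M.IsComponentIso N K (π K) (g K) := by
  have hk' : s + 2 < k := hM.room
  obtain ⟨f, hf⟩ := hMN.exists_equiv_sameType (by omega)
  have hcomp : ∀ x, N.metTypes N (N.excGraph.connectedComponentMk (f x)) =
      M.metTypes N (M.excGraph.connectedComponentMk x) := fun x =>
    have ⟨_, hg⟩ := hM.exists_isComponentIso hk (hf x)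
    hg.metTypes_eq.symm
  have hcard : ∀ K K', M.metTypes N K = N.metTypes N K' → K.supp.ncard = K'.supp.ncard :=
    fun K K' h =>
      have ⟨_, hg⟩ := hM.exists_isComponentIso_of_metTypes_eq hk hMN h
      hg.ncard_supp_eq (by omega)
  obtain ⟨π, hπ⟩ :=
    exists_equiv_of_ncard_fiber_eq Quot.mk_surjective Quot.mk_surjective f hcomp hcard
  choose g hg using fun K => hM.exists_isComponentIso_of_metTypes_eq hk hMN (hπ K).symm
  exact ⟨π, g, hg⟩

lemma exists_equiv_samePairType (hMN : M.Sim N ∅) :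
    ∃ e : V ≃ W, ∀ x y, M.SamePairType N x y (e x) (e y) := by
  have hk' : s + 2 < k := hM.room
  obtain ⟨π, g, hg⟩ := hM.exists_equiv_isComponentIso hk hMN
  let c := M.excGraph.connectedComponentMk
  let e : V → W := fun x => g (c x) x
  have comp_e : ∀ x, N.excGraph.connectedComponentMk (e x) = π (c x) := fun x =>
    (hg (c x)).image_supp.subset ⟨x, rfl, rfl⟩
  have same_comp : ∀ x y, c x = c y → M.SamePairType N x y (e x) (e y) := by
    intro x y hxy
    simpa only [e, ← hxy] using (hg (c x)).samePairType x rfl y hxy.symm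
  have he : e.Bijective := by
    refine ⟨fun x y hxy => ?_, fun y => ?_⟩
    · have hcxy : c x = c y := π.injective (by rw [← comp_e, ← comp_e, hxy])
      exact ((same_comp x y hcxy).eq_iff (by omega)).2 hxy
    · obtain ⟨K, hK⟩ := π.surjective (N.excGraph.connectedComponentMk y)
      obtain ⟨x, rfl, hx⟩ := (hg K).image_supp.superset hK.symm
      exact ⟨x, hx⟩
  refine ⟨Equiv.ofBijective e he, fun x y => ?_⟩
  by_cases hxy : c x = c y
  · exact same_comp x y hxy
  · refine (same_comp x x rfl).left.samePairType_of_not_exceptional (same_comp y y rfl).left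
      (fun h => hxy (h.connectedComponentMk_eq (by omega))) (fun h => hxy (π.injective ?_))
      (by omega)
    rw [← comp_e, ← comp_e]
    exact h.connectedComponentMk_eq (by omega)

end Terminal

end PebbledGraph

/-- The number of variables that suffice for graphs with `n` vertices: with gain parameter `L`, at
most `n * (L + 3) / (4 * L)` pebbles are placed greedily, and the remaining ones serve to explore
components. -/
def numVars (L n : ℕ) : ℕ := n * (L + 3) / (4 * L) + (3 * PebbledGraph.compBound L + 4)

lemma numVars_pos (L n : ℕ) : 0 < numVars L n :=
  Nat.lt_of_lt_of_le (Nat.succ_pos _) (Nat.le_add_left _ _)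

namespace PebbledGraph

variable {C : Type w} {V : Type u} {W : Type v} {k s L : ℕ}
variable [Fintype V] [Finite W]

open Classical in
lemma Sim.exists_cons_of_not_terminal {M : PebbledGraph C V k s} {N : PebbledGraph C W k s}
    [NeZero s] (h : M.Sim N ∅) (hk : s + 2 < k) (hM : ¬ M.Terminal L) :
    ∃ x y, (cons x M).Sim (cons y N) ∅ ∧
      potential L M.typeClass + 4 * L ≤ potential L (cons x M).typeClass := by
  obtain ⟨x, hx⟩ : ∃ x, potential L M.typeClass + 4 * L ≤ potential L (M.cell x) := by
    by_contra! hgain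
    exact hM ⟨hk, hgain⟩
  obtain ⟨y, hy⟩ := h.exists_pair (by rw [Set.ncard_empty]; omega) x
  exact ⟨x, y, sim_cons.2 hy, hx⟩

open Classical in
lemma exists_terminal {G : SimpleGraph V} {P : C → Set V} {H : SimpleGraph W} {Q : C → Set W}
    {x₀ : V} {y₀ : W} (hL : 0 < L) (hk : numVars L (Fintype.card V) ≤ k)
    (h : CFormula.theory G P (fun _ : Fin k => x₀) = CFormula.theory H Q fun _ => y₀) :
    ∃ (t : ℕ) (a : Fin (t + 1) → V) (b : Fin (t + 1) → W),
      Terminal (⟨G, P, a⟩ : PebbledGraph C V k (t + 1)) L ∧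
      Sim (⟨G, P, a⟩ : PebbledGraph C V k (t + 1)) ⟨H, Q, b⟩ ∅ ∧
      t + 1 + 3 * compBound L ≤ k := by
  let p : ℕ → Prop := fun t => ∃ (a : Fin (t + 1) → V) (b : Fin (t + 1) → W),
    Sim (⟨G, P, a⟩ : PebbledGraph C V k (t + 1)) ⟨H, Q, b⟩ ∅ ∧
      4 * L * t ≤ potential L (⟨G, P, a⟩ : PebbledGraph C V k (t + 1)).typeClass
  have hbound : ∀ t, p t → t ≤ Fintype.card V * (L + 3) / (4 * L) := by
    rintro t ⟨a, b, -, ht⟩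
    rw [Nat.le_div_iff_mul_le (by omega), mul_comm]
    exact ht.trans (potential_le L _)
  have hp₀ : p 0 := by
    refine ⟨fun _ => x₀, fun _ => y₀, fun a ha => ?_, by simp⟩
    obtain rfl : a = fun _ => (x₀, y₀) := funext fun i => by simpa [pebPairs] using ha i
    exact h
  obtain ⟨t, ⟨a, b, hsim, ht⟩, hmax⟩ : ∃ t, p t ∧ ¬ p (t + 1) := by
    by_contra! hstep
    have hp : ∀ t, p t := fun t => Nat.rec hp₀ hstep t
    have := hbound _ (hp (Fintype.card V * (L + 3) / (4 * L) + 1))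
    omega
  have htk : t + 3 * compBound L + 4 ≤ k := by
    have := hbound t ⟨a, b, hsim, ht⟩
    rw [numVars] at hk
    omega
  refine ⟨t, a, b, ?_, hsim, by omega⟩
  by_contra hterm
  obtain ⟨x, y, hxy, hgain⟩ := hsim.exists_cons_of_not_terminal (by omega) hterm
  refine hmax ⟨Fin.cons x a, Fin.cons y b, hxy, le_trans ?_ hgain⟩
  rw [mul_add_one]
  omega

end PebbledGraph

namespace CFormula

variable {C : Type w} {V : Type u} {W : Type v} {k L : ℕ}

section Isomorphisms

variable {G : SimpleGraph V} {P : C → Set V} {H : SimpleGraph W} {Q : C → Set W}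

lemma nonempty_iso_of_forall_realize [Fintype V] [Nonempty V] [Finite W] [Nonempty W]
    (hL : 0 < L) (hk : numVars L (Fintype.card V) ≤ k)
    (h : ∀ φ : CFormula C k, φ.IsSentence → (∀ a, φ.Realize G P a) → ∀ b, φ.Realize H Q b) :
    Nonempty (Iso G P H Q) := by
  obtain ⟨x₀⟩ := ‹Nonempty V›
  have : NeZero k := ⟨((numVars_pos _ _).trans_le hk).ne'⟩
  obtain ⟨y₀, hy₀⟩ := exists_theory_const_eq h x₀
  obtain ⟨t, a, b, hterm, hsim, ht⟩ := PebbledGraph.exists_terminal hL hk hy₀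
  obtain ⟨e, he⟩ := hterm.exists_equiv_samePairType ht hsim
  have hk' : 1 < k := by have := hterm.room; omega
  exact ⟨⟨⟨e, fun {x y} => ((he x y).adj_iff hk' (by simp) (by simp)).symm⟩,
    fun c x => (he x x).mem_col_iff (by omega) (by simp) c⟩⟩

lemma exists_realize_imp_nonempty_iso [Fintype V] [Nonempty V] [Finite W] [Nonempty W]
    (hL : 0 < L) (hk : numVars L (Fintype.card V) ≤ k) (G : SimpleGraph V) (P : C → Set V)
    (H : SimpleGraph W) (Q : C → Set W) : ∃ φ : CFormula C k, φ.IsSentence ∧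
      (∀ a, φ.Realize G P a) ∧ ((∀ b, φ.Realize H Q b) → Nonempty (Iso G P H Q)) := by
  by_contra! hsep
  obtain ⟨e⟩ := nonempty_iso_of_forall_realize hL hk fun φ hφ hG => (hsep φ hφ hG).1
  exact (hsep (conj []) rfl (by simp)).2.false e

/-- The inverse of an isomorphism of graphs with color classes. -/
def Iso.symm (e : Iso G P H Q) : Iso H Q G P :=
  ⟨e.toRelIso.symm, fun c y => by simpa using (e.mem_color_iff c (e.toRelIso.symm y)).symm⟩

/-- The composition of two isomorphisms of graphs with color classes. -/
def Iso.trans {U : Type*} {H' : SimpleGraph U} {Q' : C → Set U} (e : Iso G P H Q)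
    (e' : Iso H Q H' Q') : Iso G P H' Q' :=
  ⟨e.toRelIso.trans e'.toRelIso, fun c x =>
    (e.mem_color_iff c x).trans (e'.mem_color_iff c (e.toRelIso x))⟩

end Isomorphisms

section Sentences

/-- The sentence stating that there are exactly `n` vertices. -/
def cardSentence (C : Type w) (i : Fin k) (n : ℕ) : CFormula C k :=
  conj [atLeast n i (conj []), neg (atLeast (n + 1) i (conj []))]

lemma isSentence_cardSentence (i : Fin k) (n : ℕ) : (cardSentence C i n).IsSentence := by
  have hatLeast : ∀ m, (atLeast m i (conj []) : CFormula C k).IsSentence := fun _ =>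
    Finset.erase_eq_of_notMem (Finset.notMem_empty i)
  refine isSentence_conj fun φ hφ => ?_
  simp only [List.mem_cons, List.not_mem_nil, or_false] at hφ
  obtain rfl | rfl := hφ
  exacts [hatLeast n, (hatLeast (n + 1)).neg]

lemma realize_cardSentence [Finite W] (i : Fin k) (n : ℕ) (H : SimpleGraph W) (Q : C → Set W)
    (a : Fin k → W) : (cardSentence C i n).Realize H Q a ↔ Nat.card W = n := by
  have hatLeast : ∀ m, (atLeast m i (conj [])).Realize H Q a ↔ m ≤ Nat.card W := fun _ => by
    simp [realize_atLeast, Set.ncard_univ]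
  simp only [cardSentence, realize_conj, List.mem_cons, List.not_mem_nil, or_false,
    forall_eq_or_imp, forall_eq, realize_neg, hatLeast]
  omega

/-- The sentence stating that every vertex has a color in `D`. -/
noncomputable def paletteSentence (D : Finset C) (i : Fin k) : CFormula C k :=
  univClosure (neg (conj (D.toList.map fun c => neg (color c i))))

lemma realize_paletteSentence (D : Finset C) (i : Fin k) (H : SimpleGraph W) (Q : C → Set W)
    (a : Fin k → W) :
    (paletteSentence D i).Realize H Q a ↔ ∀ x, ∃ c ∈ D, x ∈ Q c := by
  have hcolor : ∀ b : Fin k → W,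
      (neg (conj (D.toList.map fun c => neg (color c i)))).Realize H Q b ↔
        ∃ c ∈ D, b i ∈ Q c := fun b => by simp [Realize]
  simp only [paletteSentence, realize_univClosure, hcolor]
  exact ⟨fun h x => h fun _ => x, fun h b => h (b i)⟩

end Sentences

/-- The structures on `n` vertices with colors in a finite set `D`, up to isomorphism. -/
abbrev FinModel (D : Finset C) (n : ℕ) : Type w := SimpleGraph (Fin n) × (D → Set (Fin n))

/-- The color classes of a structure, which are empty for colors outside `D`. -/
def FinModel.col {D : Finset C} {n : ℕ} (z : FinModel D n) (c : C) : Set (Fin n) :=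
  {x | ∃ h : c ∈ D, x ∈ z.2 ⟨c, h⟩}

lemma FinModel.exists_iso [Finite W] (D : Finset C) {n : ℕ} (hn : Nat.card W = n)
    (H : SimpleGraph W) {Q : C → Set W} (hQ : ∀ c ∉ D, Q c = ∅) :
    ∃ z : FinModel D n, Nonempty (Iso H Q z.1 z.col) := by
  let f : W ≃ Fin n := Finite.equivFinOfCardEq hn
  refine ⟨(H.comap f.symm, fun c => f.symm ⁻¹' Q c), ⟨⟨⟨f, by simp⟩, fun c x => ?_⟩⟩⟩
  by_cases hc : c ∈ D
  · simp [col, hc]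
  · simp [col, hc, hQ c hc]

lemma exists_defining_sentence [Fintype V] [Nonempty V] (hL : 0 < L)
    (hk : numVars L (Fintype.card V) ≤ k) (G : SimpleGraph V) (P : C → Set V) (D : Finset C) :
    ∃ φ : CFormula C k, φ.IsSentence ∧ ∀ (W : Type v) [Finite W] [Nonempty W]
      (H : SimpleGraph W) (Q : C → Set W), (∀ c ∉ D, Q c = ∅) →
      ((∀ a, φ.Realize H Q a) ↔ Nonempty (Iso H Q G P)) := by
  have : NeZero (Fintype.card V) := ⟨Fintype.card_ne_zero⟩
  let i : Fin k := ⟨0, (numVars_pos _ _).trans_le hk⟩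
  cases nonempty_fintype (FinModel D (Fintype.card V))
  choose ψ hψ hG hiso using fun z : FinModel D (Fintype.card V) =>
    exists_realize_imp_nonempty_iso hL hk G P z.1 z.col
  let φ : CFormula C k := conj (cardSentence C i (Fintype.card V) :: Finset.univ.toList.map ψ)
  have realize_φ : ∀ {U : Type v} [Finite U] (H : SimpleGraph U) (Q : C → Set U) (a : Fin k → U),
      φ.Realize H Q a ↔ Nat.card U = Fintype.card V ∧ ∀ z, (ψ z).Realize H Q a := fun H Q a => by
    simp only [φ, realize_conj, List.forall_mem_cons, List.forall_mem_map, Finset.mem_toList,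
      Finset.mem_univ, forall_const, realize_cardSentence]
  refine ⟨φ, isSentence_conj ?_, fun W _ _ H Q hQ => ⟨fun h => ?_, ?_⟩⟩
  · exact List.forall_mem_cons.2
      ⟨isSentence_cardSentence _ _, List.forall_mem_map.2 fun z _ => hψ z⟩
  · obtain ⟨w₀⟩ := ‹Nonempty W›
    have hcard := ((realize_φ H Q _).1 (h fun _ => w₀)).1
    obtain ⟨z, ⟨e⟩⟩ := FinModel.exists_iso D hcard H hQ
    obtain ⟨e'⟩ := hiso z fun b =>
      (e.symm.realize_iff (ψ z) b).2 (((realize_φ H Q _).1 (h _)).2 z)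
    exact ⟨e.trans e'.symm⟩
  · rintro ⟨e⟩ a
    rw [realize_φ, Nat.card_congr e.toEquiv, Nat.card_eq_fintype_card]
    exact ⟨rfl, fun z => (e.realize_iff _ _).2 (hG z _)⟩

end CFormula

section Definability

variable {V : Type u} [Fintype V] [Nonempty V] {k L : ℕ}

open CFormula

lemma definableInC_of_numVars_le (hL : 0 < L) (hk : numVars L (Fintype.card V) ≤ k)
    (G : SimpleGraph V) : DefinableInC.{u, v} k G := by
  obtain ⟨φ, hφ, h⟩ := exists_defining_sentence.{u, v} hL hk G (fun c : Empty => c.elim) ∅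
  exact ⟨φ, hφ, fun W _ _ H => (h W H (fun c => c.elim) fun c => c.elim).trans
    ⟨fun ⟨e⟩ => ⟨e.toRelIso⟩, fun ⟨e⟩ => ⟨⟨e, fun c => c.elim⟩⟩⟩⟩

lemma definableInCColored_of_numVars_le {C : Type w} (hL : 0 < L)
    (hk : numVars L (Fintype.card V) ≤ k) (G : SimpleGraph V) (χ : V → C) :
    DefinableInCColored.{u, v, w} k G χ := by
  classical
  let D : Finset C := Finset.univ.image χ
  let i : Fin k := ⟨0, (numVars_pos _ _).trans_le hk⟩
  obtain ⟨φ, hφ, h⟩ := exists_defining_sentence.{u, v} hL hk G (fun c => {x | χ x = c}) D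
  refine ⟨conj [paletteSentence D i, φ], isSentence_conj ?_, fun W _ _ H η => ?_⟩
  · simpa using ⟨isSentence_univClosure _, hφ⟩
  have hmodels : ModelsColored H η (conj [paletteSentence D i, φ]) ↔
      (∀ x, η x ∈ D) ∧ ∀ a, φ.Realize H (fun c => {x | η x = c}) a := by
    simp [ModelsColored, realize_paletteSentence, forall_and]
  have empty_of_notMem : (∀ x, η x ∈ D) → ∀ c ∉ D, {x | η x = c} = ∅ := fun hη c hc =>
    Set.eq_empty_of_forall_notMem fun x hx => hc (hx ▸ hη x)
  rw [hmodels]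
  constructor
  · rintro ⟨hη, hφH⟩
    obtain ⟨e⟩ := (h W H _ (empty_of_notMem hη)).1 hφH
    exact ⟨e.toRelIso, fun x => (e.mem_color_iff (η x) x).1 rfl⟩
  · rintro ⟨e, he⟩
    have hη : ∀ x, η x ∈ D := fun x => by simp [D, ← he x]
    exact ⟨hη, (h W H _ (empty_of_notMem hη)).2 ⟨⟨e, fun c x => by
      rw [Set.mem_ofPred_eq, ← he x]; rfl⟩⟩⟩

end Definability

section Asymptotics

/-- The minimum over all gain parameters `L` of the number of variables; choosing `L` after `n` is
what makes the error term sublinear. -/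
noncomputable def minVars (n : ℕ) : ℕ := sInf {m | ∃ L, 0 < L ∧ numVars L n = m}

lemma exists_numVars_eq_minVars (n : ℕ) : ∃ L, 0 < L ∧ numVars L n = minVars n :=
  Nat.sInf_mem (s := {m | ∃ L, 0 < L ∧ numVars L n = m}) ⟨_, 1, one_pos, rfl⟩

lemma minVars_le_numVars {L : ℕ} (hL : 0 < L) (n : ℕ) : minVars n ≤ numVars L n :=
  Nat.sInf_le ⟨L, hL, rfl⟩

lemma cast_mul_add_div_four_mul {L : ℕ} (hL : 0 < L) (n : ℕ) :
    ((n * (L + 3) : ℕ) : ℝ) / ((4 * L : ℕ) : ℝ) = n / 4 + n * (3 / (4 * L)) := by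
  have hL' : (L : ℝ) ≠ 0 := by exact_mod_cast hL.ne'
  push_cast
  field_simp

lemma div_four_le_numVars {L : ℕ} (hL : 0 < L) (n : ℕ) : (n : ℝ) / 4 ≤ numVars L n := by
  have hlt : (n : ℝ) / 4 + n * (3 / (4 * L)) < ((n * (L + 3) / (4 * L) : ℕ) : ℝ) + 1 := by
    rw [← cast_mul_add_div_four_mul hL, ← Nat.floor_div_eq_div (K := ℝ)]
    exact Nat.lt_floor_add_one _
  have herror : (0 : ℝ) ≤ n * (3 / (4 * L)) := by positivity
  rw [numVars]
  push_cast at hlt ⊢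
  linarith

lemma numVars_le {L : ℕ} (hL : 0 < L) (n : ℕ) :
    (numVars L n : ℝ) ≤ n / 4 + n * (3 / (4 * L)) + (3 * PebbledGraph.compBound L + 4) := by
  rw [numVars, ← cast_mul_add_div_four_mul hL]
  push_cast
  gcongr
  exact_mod_cast Nat.cast_div_le (α := ℝ) (m := n * (L + 3)) (n := 4 * L)

lemma minVars_isLittleO : (fun n : ℕ => (minVars n : ℝ) - (n : ℝ) / 4) =o[Filter.atTop]
    (fun n : ℕ => (n : ℝ)) := by
  rw [Asymptotics.isLittleO_iff]
  intro ε hε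
  obtain ⟨L, hL⟩ := exists_nat_gt (2 / ε)
  have hL₀ : (0 : ℝ) < L := lt_trans (by positivity) hL
  have hL₁ : 0 < L := by exact_mod_cast hL₀
  have hslope : (3 : ℝ) / (4 * L) ≤ ε / 2 := by
    rw [div_le_iff₀ (by positivity)]
    rw [div_lt_iff₀ hε] at hL
    linarith
  filter_upwards [tendsto_natCast_atTop_atTop.eventually_ge_atTop
    ((3 * PebbledGraph.compBound L + 4) / (ε / 2))] with n hn
  have hlower : (n : ℝ) / 4 ≤ minVars n := by
    obtain ⟨L', hL', h⟩ := exists_numVars_eq_minVars n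
    exact h ▸ div_four_le_numVars hL' n
  have hupper : (minVars n : ℝ) - n / 4 ≤ ε * n := calc
    (minVars n : ℝ) - n / 4 ≤ numVars L n - n / 4 := by
      gcongr
      exact minVars_le_numVars hL₁ n
    _ ≤ n * (3 / (4 * L)) + (3 * PebbledGraph.compBound L + 4) := by
      linarith [numVars_le hL₁ n]
    _ ≤ n * (ε / 2) + n * (ε / 2) := by
      gcongr
      rwa [div_le_iff₀ (by positivity)] at hn
    _ = ε * n := by ring
  rwa [Real.norm_of_nonneg (sub_nonneg.2 hlower), Real.norm_of_nonneg (Nat.cast_nonneg n)]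

end Asymptotics

theorem corollary2 :
    ∃ k : ℕ → ℕ,
      (fun n : ℕ => (k n : ℝ) - (n : ℝ) / 4) =o[Filter.atTop] (fun n : ℕ => (n : ℝ)) ∧
      (∀ (V : Type u) [Fintype V] [Nonempty V] (G : SimpleGraph V),
        DefinableInC.{u, v} (k (Fintype.card V)) G) ∧
      (∀ (V : Type u) [Fintype V] [Nonempty V] (C : Type w) (G : SimpleGraph V) (χ : V → C),
        DefinableInCColored.{u, v, w} (k (Fintype.card V)) G χ) := by
  refine ⟨minVars, minVars_isLittleO, fun V _ _ G => ?_, fun V _ _ C G χ => ?_⟩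
  · obtain ⟨L, hL, h⟩ := exists_numVars_eq_minVars (Fintype.card V)
    exact definableInC_of_numVars_le hL h.le G
  · obtain ⟨L, hL, h⟩ := exists_numVars_eq_minVars (Fintype.card V)
    exact definableInCColored_of_numVars_le hL h.le G χ
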